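/- Let $(\varphi_p)_{p\in\mathbb N}$ be an acceptable programming system (Gödel numbering of the partial computable functions $\mathbb N\rightharpoonup\mathbb N$) and $W_p=\mathrm{dom}(\varphi_p)$. Languages are the computably enumerable sets $L\subseteq\mathbb N$. A text for $L$ is a sequence $T\in(\mathbb N\cup\{\#\})^{\mathbb N}$ in which exactly the elements of $L$ (and possibly the pause symbol $\#$) occur; its content is $\mathrm{content}(T)=L$, and $T[t]$ is its initial segment of length $t$. A bounded memory states learner $M$ is given by partial computable functions $h_M:\mathbb N\times(\mathbb N\cup\{\#\})\rightharpoonup\mathbb N\cup\{?\}$ and $s_M:\mathbb N\times(\mathbb N\cup\{\#\})\rightharpoonup\mathbb N$ with the same domain. Put $s_M^*(\epsilon)=0$, $s_M^*(\sigma x)=s_M(s_M^*(\sigma),x)$, $M(\epsilon)=\;?$ and $M(\sigma x)=h_M(s_M^*(\sigma),x)$. Write $h_t=M(T[t])$. The output $?$ means "no hypothesis, or repetition of the last one"; in the conditions below the indices range only over those $t$ with $h_t\neq\;?$. For a text $T$ we say that $M$ on $T$ - uses finitely many states, if $\{s_M^*(T[t])\mid t\in\mathbb N\}$ is finite; - is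 $\mathbf{Ex}$-successful, if all $h_t$ are defined and there is $t_0$ with $W_{h_{t_0}}=\mathrm{content}(T)$ and $h_t=h_{t_0}$ for all $t\ge t_0$; - is conservative ($\mathbf{Conv}$), if for all $s\le t$: $\mathrm{content}(T[t])\subseteq W_{h_s}$ implies $h_s=h_t$; - is monotonic ($\mathbf{Mon}$), if $W_{h_s}\cap\mathrm{content}(T)\subseteq W_{h_t}\cap\mathrm{content}(T)$ for all $s\le t$; - is strongly monotonic ($\mathbf{SMon}$), if $W_{h_s}\subseteq W_{h_t}$ for all $s\le t$; - is strongly non-U-shaped ($\mathbf{SNU}$), if for all $r\le s\le t$: $W_{h_r}=W_{h_t}=\mathrm{content}(T)$ implies $h_r=h_s$. For a restriction $\delta$ let $[\mathbf{TxtBMS}_*\delta\mathbf{Ex}]$ be the set of all collections $\mathcal L$ of languages for which there is one bounded memory states learner that, on every text for every $L\in\mathcal L$, uses finitely many states, satisfies $\delta$ and is $\mathbf{Ex}$-successful; without $\delta$ write $[\mathbf{TxtBMS}_*\mathbf{Ex}]$. Then, with respect to inclusion, $[\mathbf{TxtBMS}_*\mathbf{Conv}\,\mathbf{Ex}]$ is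 incomparable with $[\mathbf{TxtBMS}_*\mathbf{SMon}\,\mathbf{Ex}]$, and it is incomparable with $[\mathbf{TxtBMS}_*\mathbf{Mon}\,\mathbf{Ex}]$. The remaining relations between the four classes given by no restriction, $\mathbf{Mon}$, $\mathbf{SMon}$ and $\mathbf{Conv}$ are $$[\mathbf{TxtBMS}_*\mathbf{SMon}\,\mathbf{Ex}]\subsetneq[\mathbf{TxtBMS}_*\mathbf{Mon}\,\mathbf{Ex}]\subsetneq[\mathbf{TxtBMS}_*\mathbf{Ex}],\qquad [\mathbf{TxtBMS}_*\mathbf{Conv}\,\mathbf{Ex}]\subsetneq[\mathbf{TxtBMS}_*\mathbf{Ex}],$$ and also $[\mathbf{TxtBMS}_*\mathbf{SNU}\,\mathbf{Ex}]\subsetneq[\mathbf{TxtBMS}_*\mathbf{Ex}]$. -/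

import Mathlib

/-! ### Programming systems -/

/-- An acceptable programming system (Gödel numbering of the partial computable functions):
`φ p` is the partial computable function with program code `p`.  The system has a universal
function, and every uniformly computable family of programs translates computably into it. -/
structure AcceptableSystem (φ : ℕ → ℕ →. ℕ) : Prop where
  universal : Partrec₂ φ
  translate : ∀ ψ : ℕ → ℕ →. ℕ, Partrec₂ ψ →
    ∃ c : ℕ → ℕ, Computable c ∧ ∀ e x, φ (c e) x = ψ e x

/-- The language `W_p`, the domain of `φ p`. -/
def langOf (φ : ℕ → ℕ →. ℕ) (p : ℕ) : Set ℕ := {x | (φ p x).Dom}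

/-! ### Data, hypotheses, texts -/

/-- The input alphabet `ℕ ∪ {#}`; `none` is the pause symbol `#`. -/
abbrev Datum : Type := Option ℕ

/-- The output alphabet `ℕ ∪ {?}`; `none` is the symbol `?`, which stands for no hypothesis, or
for the repetition of the last hypothesis. -/
abbrev Output : Type := Option ℕ

/-- Infinite sequences of data. -/
abbrev Text : Type := ℕ → Datum

namespace Text

/-- The initial segment `T[t] = (T 0, …, T (t - 1))`. -/
def take (T : Text) (t : ℕ) : List Datum := (List.range t).map T

/-- The set of all numbers occurring in a text. -/
def content (T : Text) : Set ℕ := {x | ∃ i, T i = some x}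

end Text

/-- The set of all numbers occurring in a finite sequence of data. -/
def listContent (σ : List Datum) : Set ℕ := {x | some x ∈ σ}

/-- Partial functions from finite sequences of data to outputs. -/
abbrev Learner : Type := List Datum →. Output

/-! ### Bounded memory states learners -/

/-- A bounded memory states learner, given by its hypothesis generating function `h` and its state
transition function `s`, partial computable functions with the same domain. -/
structure BMSLearner where
  h : ℕ → Datum →. Output
  s : ℕ → Datum →. ℕ
  h_partrec : Partrec₂ h
  s_partrec : Partrec₂ s
  dom_eq : ∀ q x, (h q x).Dom ↔ (s q x).Dom

namespace BMSLearner

/-- The state `s*(σ)` reached from the initial state `0` on the sequence `σ`. -/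
def state (M : BMSLearner) (σ : List Datum) : Part ℕ :=
  σ.foldl (fun q x => q.bind fun q => M.s q x) (Part.some 0)

/-- The output `h*(σ)`; it is `?` on the empty sequence. -/
def hyp (M : BMSLearner) : Learner := fun σ =>
  match σ.getLast? with
  | none => Part.some none
  | some x => (M.state σ.dropLast).bind fun q => M.h q x

theorem state_nil (M : BMSLearner) : M.state [] = Part.some 0 := rfl

theorem state_append (M : BMSLearner) (σ : List Datum) (x : Datum) :
    M.state (σ ++ [x]) = (M.state σ).bind fun q => M.s q x := by
  simp [state]

theorem hyp_nil (M : BMSLearner) : M.hyp [] = Part.some none := rfl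

theorem hyp_append (M : BMSLearner) (σ : List Datum) (x : Datum) :
    M.hyp (σ ++ [x]) = (M.state σ).bind fun q => M.h q x := by
  simp [hyp]

/-- `M` visits only finitely many states on the text `T`. -/
def FinitelyManyStates (M : BMSLearner) (T : Text) : Prop :=
  {q : ℕ | ∃ t, q ∈ M.state (T.take t)}.Finite

end BMSLearner

/-! ### Explanatory convergence and learning restrictions

In all clauses `some p ∈ M (T.take t)` says that the learner puts out the proper hypothesis `p`
after having seen the first `t` data.  The output `?` is no hypothesis of its own, so that the
clauses compare proper hypotheses only; this is the same as first replacing each `?` by the last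
proper hypothesis before it, if there is one. -/

/-- `M` is defined along `T`, and its hypotheses converge to a single correct one. -/
def LearnsEx (φ : ℕ → ℕ →. ℕ) (M : Learner) (T : Text) : Prop :=
  (∀ t, (M (T.take t)).Dom) ∧
  ∃ t₀ p, some p ∈ M (T.take t₀) ∧ langOf φ p = T.content ∧
    ∀ t, t₀ ≤ t → ∀ q, some q ∈ M (T.take t) → q = p

/-- No restriction. -/
def Unrestricted (_φ : ℕ → ℕ →. ℕ) (_M : Learner) (_T : Text) : Prop := True

/-- `M` is conservative on `T`. -/
def Conservative (φ : ℕ → ℕ →. ℕ) (M : Learner) (T : Text) : Prop :=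
  ∀ s t p q, s ≤ t → some p ∈ M (T.take s) → some q ∈ M (T.take t) →
    listContent (T.take t) ⊆ langOf φ p → p = q

/-- `M` is monotonic on `T`. -/
def Monotonic (φ : ℕ → ℕ →. ℕ) (M : Learner) (T : Text) : Prop :=
  ∀ s t p q, s ≤ t → some p ∈ M (T.take s) → some q ∈ M (T.take t) →
    langOf φ p ∩ T.content ⊆ langOf φ q ∩ T.content

/-- `M` is strongly monotonic on `T`. -/
def StronglyMonotonic (φ : ℕ → ℕ →. ℕ) (M : Learner) (T : Text) : Prop :=
  ∀ s t p q, s ≤ t → some p ∈ M (T.take s) → some q ∈ M (T.take t) →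
    langOf φ p ⊆ langOf φ q

/-- `M` is strongly non-U-shaped on `T`. -/
def StronglyNonUShaped (φ : ℕ → ℕ →. ℕ) (M : Learner) (T : Text) : Prop :=
  ∀ r s t p q p', r ≤ s → s ≤ t →
    some p ∈ M (T.take r) → some q ∈ M (T.take s) → some p' ∈ M (T.take t) →
    langOf φ p = T.content → langOf φ p' = T.content → p = q

/-- The class `[Txt BMS_* δ Ex]`: all collections of (computably enumerable) languages for which
there is one bounded memory states learner that, on every text for every language of the
collection, uses only finitely many states, obeys `δ` and converges to a correct hypothesis. -/
def TxtBMSEx (φ : ℕ → ℕ →. ℕ) (δ : (ℕ → ℕ →. ℕ) → Learner → Text → Prop) :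
    Set (Set (Set ℕ)) :=
  {𝓛 | (∀ L ∈ 𝓛, REPred fun x => x ∈ L) ∧
    ∃ M : BMSLearner, ∀ L ∈ 𝓛, ∀ T : Text, T.content = L →
      M.FinitelyManyStates T ∧ δ φ M.hyp T ∧ LearnsEx φ M.hyp T}

open Encodable
open Nat.Partrec (Code)

/-! ### Recursively enumerable predicates -/

section RecursivelyEnumerable

variable {α β γ : Type*} [Primcodable α] [Primcodable β] [Primcodable γ]

/-! Conservative learners are strongly non-U-shaped and strongly monotonic ones are monotonic, so
three separating collections give all the claims.

Two of them consist of the sets `OddBounds.lang l`: the even numbers up to the largest of finitely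
many odd numbers, together with these odd numbers; all even numbers if there is no odd one.
Remembering the odd numbers seen so far is conservative, because only an odd number outside the
current conjecture changes it. But a learner can be led from a conjecture for all even numbers to
one for the cut-off at a large `2 * n + 1`, and the data may then continue towards `{2 * n + 1, 2 *
n + 3}`. The element `2 * n + 2` is thereby given up although it belongs to the target, so the
learner is not monotonic. With at most one odd number allowed, the second conjecture is already the
target, and only strong monotonicity fails.

The third collection, `Diagonal.collection`, is strongly monotonically learnable, but not by a
strongly non-U-shaped learner. Suppose that `k` describes such a learner `M`. Search effectively for
plain elements that drive `M` into ever new states. The search must stop, as `M` would otherwise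
visit infinitely many states on the language `base k`. At the end `σ` of the search every further
plain element leads back to a state passed before, so finitely many further ones can be read without
leaving a trace in the state (`exists_loop_of_dead_end`).

After `σ` comes a mark that lists `σ`, and then pauses, on which `M` must loop with some hypothesis
`h`. A reaction is a change of `h` when plain elements are presented in this loop. If reactions
exist, the language contains the plain elements up to the time of the first one, hence all those
that cause it. Reading them before the mark, without trace, makes `h` correct; reading them again
after the mark makes `M` drop the correct `h`, against strong non-U-shapedness
(`Describes.reactsAt_eq_false`). If there is no reaction, `h` is correct for `σ` with the mark and
is also kept on the text of all plain elements, so `M` fails on one of these two languages. The bit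
in a mark forces `M` to put out `h` after one of the two marks
(`Describes.exists_output_after_mark`); an output from before the mark would not be reproduced by
the detour.

A strongly monotonic learner passes from `∅` to `base k`, to the small and then to the large
language of the mark, as the data demand. If a reaction exists, the last two languages coincide, and
the last step is a harmless change of index. -/

theorem REPred.exists_primrec {p : α → Prop} (hp : REPred p) :
    ∃ R : α → ℕ → Bool, Primrec₂ R ∧ ∀ a, p a ↔ ∃ s, R a s = true := by
  obtain ⟨c, hc⟩ := Nat.Partrec.Code.exists_code.1 hp
  refine ⟨fun a s => (c.evaln s (encode a)).isSome, ?_, fun a => ?_⟩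
  · exact Primrec.option_isSome.comp (Nat.Partrec.Code.primrec_evaln.comp
      ((Primrec.snd.pair (Primrec.const c)).pair (Primrec.encode.comp Primrec.fst)))
  · have h1 : (c.eval (encode a)).Dom ↔ p a := by
      rw [hc]; simp [Part.assert]
    rw [← h1, Part.dom_iff_mem]
    simp only [Nat.Partrec.Code.evaln_complete, Option.isSome_iff_exists, Option.mem_def]
    exact exists_comm

theorem Primrec₂.re_exists {R : α → ℕ → Bool} (hR : Primrec₂ R) :
    REPred fun a => ∃ s, R a s = true := by
  have h : Partrec fun a => Nat.rfindOpt fun s => if R a s = true then some () else none :=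
    Partrec.rfindOpt (Primrec.ite (Primrec.eq.comp hR (Primrec.const true))
      (Primrec.const (some ())) (Primrec.const none)).to_comp
  refine h.dom_re.of_eq fun a => ?_
  simp [Nat.rfindOpt_dom]

/-- Uniformization: witnesses of a recursively enumerable relation can be found effectively. -/
theorem REPred.exists_select {p : α × β → Prop} (hp : REPred p) :
    ∃ f : α →. β, Partrec f ∧ (∀ a, ∀ b ∈ f a, p (a, b)) ∧ ∀ a b, p (a, b) → (f a).Dom := by
  obtain ⟨R, hR, h⟩ := hp.exists_primrec
  let g : α → ℕ → Option β := fun a s => (decode (α := β) s.unpair.1).bind fun b =>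
    if R (a, b) s.unpair.2 = true then some b else none
  have hg : Primrec₂ g := by
    refine Primrec.option_bind
      (Primrec.decode.comp (Primrec.fst.comp (Primrec.unpair.comp Primrec.snd))) ?_
    exact Primrec.ite (Primrec.eq.comp (hR.comp
      ((Primrec.fst.comp Primrec.fst).pair Primrec.snd)
      (Primrec.snd.comp (Primrec.unpair.comp (Primrec.snd.comp Primrec.fst))))
      (Primrec.const true)) (Primrec.option_some.comp Primrec.snd) (Primrec.const none)
  refine ⟨fun a => Nat.rfindOpt (g a), Partrec.rfindOpt hg.to_comp, fun a b hb => ?_,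
    fun a b hab => ?_⟩
  · obtain ⟨s, hs⟩ := Nat.rfindOpt_spec hb
    simp only [g, Option.mem_def, Option.bind_eq_some_iff, Option.ite_none_right_eq_some,
      Option.some.injEq] at hs
    obtain ⟨b', -, h1, rfl⟩ := hs
    exact (h _).2 ⟨_, h1⟩
  · obtain ⟨s, hs⟩ := (h _).1 hab
    refine Nat.rfindOpt_dom.2 ⟨Nat.pair (encode b) s, b, ?_⟩
    simp [g, hs]

theorem REPred.exists {p : α × β → Prop} (hp : REPred p) : REPred fun a => ∃ b, p (a, b) := by
  obtain ⟨f, hf, h1, h2⟩ := hp.exists_select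
  refine hf.dom_re.of_eq fun a => ⟨fun h => ⟨(f a).get h, h1 _ _ (Part.get_mem h)⟩, ?_⟩
  rintro ⟨b, hb⟩
  exact h2 _ _ hb

theorem REPred.comp {p : β → Prop} (hp : REPred p) {f : α → β} (hf : Computable f) :
    REPred fun a => p (f a) :=
  Partrec.comp hp hf

theorem Partrec.exists_mem {f : α →. β} (hf : Partrec f) {p : α × β → Prop}
    (hp : PrimrecPred p) : REPred fun a => ∃ b ∈ f a, p (a, b) := by
  classical
  have h : Partrec fun a => (f a).bind fun b =>
      ((if p (a, b) then some () else Option.none : Option Unit) : Part Unit) :=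
    hf.bind (Computable.ofOption
      (Primrec.ite hp (Primrec.const (some ())) (Primrec.const Option.none)).to_comp)
  refine h.dom_re.of_eq fun a => ?_
  simp only [Part.bind_dom, Part.mem_eq]
  constructor
  · rintro ⟨h1, h2⟩
    refine ⟨_, ⟨h1, rfl⟩, ?_⟩
    by_contra h3
    simp [h3] at h2
  · rintro ⟨b, ⟨h1, rfl⟩, h2⟩
    exact ⟨h1, by simp [h2]⟩

end RecursivelyEnumerable

/-- A uniformly recursively enumerable family of sets has uniformly computable programs. -/
theorem AcceptableSystem.exists_programs {φ : ℕ → ℕ →. ℕ} (hφ : AcceptableSystem φ)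
    {S : Type*} [Primcodable S] {L : S → Set ℕ} (hL : REPred fun a : S × ℕ => a.2 ∈ L a.1) :
    ∃ c : S → ℕ, Computable c ∧ ∀ s, langOf φ (c s) = L s := by
  let ψ : ℕ → ℕ →. ℕ := fun e x => (Part.ofOption (decode (α := S) e)).bind fun s =>
    (Part.assert (x ∈ L s) fun _ => Part.some ()).map fun _ => 0
  have hψ : Partrec₂ ψ := by
    refine Partrec.bind (Computable.ofOption (Computable.decode.comp Computable.fst)) ?_
    refine Partrec.map (f := fun a : (ℕ × ℕ) × S =>
      Part.assert (a.1.2 ∈ L a.2) fun _ => Part.some ()) ?_ (Computable.const 0).to₂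
    exact hL.comp (f := fun a : (ℕ × ℕ) × S => (a.2, a.1.2))
      (Computable.snd.pair (Computable.snd.comp Computable.fst))
  obtain ⟨c, hc, h⟩ := hφ.translate ψ hψ
  refine ⟨fun s => c (encode s), hc.comp Computable.encode, fun s => ?_⟩
  ext x
  simp [langOf, h, ψ, Part.assert]

/-! ### Texts -/

namespace Text

theorem take_zero (T : Text) : T.take 0 = [] := rfl

theorem take_succ (T : Text) (t : ℕ) : T.take (t + 1) = T.take t ++ [T t] := by
  simp [take, List.range_succ]

theorem take_add (T : Text) (s n : ℕ) :
    T.take (s + n) = T.take s ++ take (fun i => T (s + i)) n := by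
  simp [take, List.range_add]

theorem length_take (T : Text) (t : ℕ) : (T.take t).length = t := by simp [take]

theorem mem_take {T : Text} {t : ℕ} {d : Datum} : d ∈ T.take t ↔ ∃ i < t, T i = d := by
  simp [take]

theorem listContent_take_subset (T : Text) (t : ℕ) : listContent (T.take t) ⊆ T.content := by
  intro x hx
  obtain ⟨i, -, hi⟩ := mem_take.1 hx
  exact ⟨i, hi⟩

/-- The text that starts with `σ` and goes on with `f`. -/
def prepend (σ : List Datum) (f : Text) : Text := fun i => (σ[i]?).getD (f (i - σ.length))

theorem take_prepend (σ : List Datum) (f : Text) (n : ℕ) :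
    (prepend σ f).take (σ.length + n) = σ ++ f.take n := by
  apply List.ext_getElem
  · simp [take]
  · intro i h1 h2
    by_cases h : i < σ.length
    · simp [take, prepend, h]
    · simp [take, prepend, h, List.getElem_append]

theorem take_prepend_length (σ : List Datum) (f : Text) : (prepend σ f).take σ.length = σ := by
  simpa [take_zero] using take_prepend σ f 0

theorem content_prepend (σ : List Datum) (f : Text) :
    (prepend σ f).content = listContent σ ∪ f.content := by
  ext x
  constructor
  · rintro ⟨i, hi⟩
    by_cases h : i < σ.length
    · left
      simp only [prepend, List.getElem?_eq_getElem h, Option.getD_some] at hi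
      exact List.mem_iff_getElem.2 ⟨i, h, hi⟩
    · right
      refine ⟨i - σ.length, ?_⟩
      simpa [prepend, h] using! hi
  · rintro (h | ⟨i, hi⟩)
    · obtain ⟨i, h1, h2⟩ := List.mem_iff_getElem.1 h
      exact ⟨i, by simp [prepend, h1, h2]⟩
    · exact ⟨σ.length + i, by simp [prepend, hi]⟩

open Classical in
/-- A text for the set `L`. -/
noncomputable def ofSet (L : Set ℕ) : Text := fun i => if i ∈ L then some i else none

theorem content_ofSet (L : Set ℕ) : (ofSet L).content = L := by
  ext x
  simp [content, ofSet]

theorem content_prepend_ofSet {σ : List Datum} {L : Set ℕ} (h : listContent σ ⊆ L) :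
    (prepend σ (ofSet L)).content = L := by
  rw [content_prepend, content_ofSet, Set.union_eq_right.2 h]

end Text

theorem listContent_append (σ τ : List Datum) :
    listContent (σ ++ τ) = listContent σ ∪ listContent τ := by
  ext x; simp [listContent]

/-! ### Learners whose hypothesis is a function of their state -/

theorem exists_learner_of_transition {S : Type*} [Primcodable S] {u : S → Datum → S}
    (hu : Computable₂ u) {s₀ : S} (h₀ : encode s₀ = 0) {c : S → ℕ} (hc : Computable c) :
    ∃ M : BMSLearner, (∀ σ, M.state σ = Part.some (encode (σ.foldl u s₀))) ∧
      ∀ σ x, M.hyp (σ ++ [x]) = Part.some (some (c ((σ ++ [x]).foldl u s₀))) := by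
  have hstep : Partrec fun a : ℕ × Datum =>
      (Part.ofOption (decode (α := S) a.1)).map fun s => u s a.2 :=
    Partrec.map (Computable.ofOption (Computable.decode.comp Computable.fst))
      (hu.comp Computable.snd (Computable.snd.comp Computable.fst)).to₂
  let M : BMSLearner :=
    { h := fun q x => ((Part.ofOption (decode (α := S) q)).map fun s => u s x).map
        fun s => some (c s)
      s := fun q x => ((Part.ofOption (decode (α := S) q)).map fun s => u s x).map encode
      h_partrec := Partrec.map hstep
        (Computable.option_some.comp (hc.comp Computable.snd)).to₂
      s_partrec := Partrec.map hstep (Computable.encode.comp Computable.snd).to₂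
      dom_eq := fun q x => Iff.rfl }
  have hs : ∀ σ, M.state σ = Part.some (encode (σ.foldl u s₀)) := by
    intro σ
    induction σ using List.reverseRecOn with
    | nil => simp [BMSLearner.state_nil, h₀]
    | append_singleton σ x ih =>
      simp [BMSLearner.state_append, ih, M]
  refine ⟨M, hs, fun σ x => ?_⟩
  simp [BMSLearner.hyp_append, hs, M]

/-- Reduces learnability to the trajectory of an explicit transition function: if the state is
eventually constant, then finitely many states are used and the hypothesis converges. The condition
`h₀` is there because every learner starts in state `0`. -/
theorem mem_txtBMSEx_of_transition {φ : ℕ → ℕ →. ℕ} (hφ : AcceptableSystem φ)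
    {δ : (ℕ → ℕ →. ℕ) → Learner → Text → Prop} {S : Type*} [Primcodable S] {u : S → Datum → S}
    (hu : Computable₂ u) {s₀ : S} (h₀ : encode s₀ = 0) {L : S → Set ℕ}
    (hL : REPred fun a : S × ℕ => a.2 ∈ L a.1) {𝓛 : Set (Set ℕ)}
    (h𝓛 : ∀ K ∈ 𝓛, ∃ s, L s = K)
    (hconv : ∀ T : Text, T.content ∈ 𝓛 →
      ∃ t₀ s, L s = T.content ∧ ∀ t, t₀ ≤ t → (T.take t).foldl u s₀ = s)
    (hδ : ∀ T : Text, T.content ∈ 𝓛 → ∀ (M : Learner) (c : S → ℕ),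
      (∀ s, langOf φ (c s) = L s) →
      (∀ t p, some p ∈ M (T.take t) → p = c ((T.take t).foldl u s₀)) → δ φ M T) :
    𝓛 ∈ TxtBMSEx φ δ := by
  obtain ⟨c, hc, hcL⟩ := hφ.exists_programs hL
  obtain ⟨M, hs, hh⟩ := exists_learner_of_transition hu h₀ hc
  refine ⟨fun K hK => ?_, M, ?_⟩
  · obtain ⟨s, rfl⟩ := h𝓛 K hK
    exact hL.comp (f := fun x : ℕ => (s, x)) ((Computable.const s).pair Computable.id)
  · rintro K hK T rfl
    have hp : ∀ t p, some p ∈ M.hyp (T.take t) → p = c ((T.take t).foldl u s₀) := by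
      intro t p h
      cases t with
      | zero => simp [Text.take_zero, BMSLearner.hyp_nil] at h
      | succ t =>
        rw [Text.take_succ] at h ⊢
        simpa [hh] using! h
    obtain ⟨t₀, s, h1, h2⟩ := hconv T hK
    -- `t₀ + 1` instead of `t₀`, since the output on the empty sequence is always `?`.
    refine ⟨?_, hδ T hK M.hyp c hcL hp, fun t => ?_, t₀ + 1, c s, ?_, by rw [hcL, h1], ?_⟩
    · refine ((Set.finite_Iic t₀).image fun t => encode ((T.take t).foldl u s₀)).subset ?_
      rintro q ⟨t, ht⟩
      rw [hs, Part.mem_some_iff] at ht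
      rcases le_total t t₀ with h | h
      · exact ⟨t, h, ht.symm⟩
      · exact ⟨t₀, Set.mem_Iic.2 le_rfl, by simp only [ht, h2 t h, h2 t₀ le_rfl]⟩
    · cases t with
      | zero => simp [Text.take_zero, BMSLearner.hyp_nil]
      | succ t => simp [Text.take_succ, hh]
    · rw [← h2 (t₀ + 1) (Nat.le_succ _), Text.take_succ, hh]
      exact Part.mem_some _
    · intro t ht q hq
      rw [hp t q hq, h2 t (by omega)]

/-! ### Unions of finite sets of odd numbers and initial segments of the even numbers -/

namespace OddBounds

/-- The even numbers, cut off above the largest element of `l` if `l` is not empty, together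
with the elements of `l`. -/
def lang (l : List ℕ) : Set ℕ := {v | v % 2 = 0 ∧ (l = [] ∨ ∃ a ∈ l, v ≤ a) ∨ ∃ a ∈ l, a = v}

/-- Collect the odd numbers. -/
def update (l : List ℕ) (d : Datum) : List ℕ :=
  d.elim l fun v => if v % 2 = 0 ∨ ∃ a ∈ l, a = v then l else v :: l

theorem primrec_update : Primrec₂ update := by
  have h1 : PrimrecPred fun a : (List ℕ × Datum) × ℕ => a.2 % 2 = 0 ∨ ∃ b ∈ a.1.1, b = a.2 :=
    (Primrec.eq.comp (Primrec.nat_mod.comp Primrec.snd (Primrec.const 2)) (Primrec.const 0)).or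
      ((Primrec.eq (α := ℕ)).exists_mem_list.comp (Primrec.fst.comp Primrec.fst) Primrec.snd)
  refine (Primrec.option_casesOn Primrec.snd Primrec.fst
    (Primrec.ite h1 (Primrec.fst.comp Primrec.fst)
      (Primrec.list_cons.comp Primrec.snd (Primrec.fst.comp Primrec.fst))).to₂).of_eq ?_
  rintro ⟨l, _ | v⟩ <;> rfl

theorem rePred_lang : REPred fun a : List ℕ × ℕ => a.2 ∈ lang a.1 := by
  refine PrimrecPred.computablePred ?_ |>.to_re
  refine ((Primrec.eq.comp (Primrec.nat_mod.comp Primrec.snd (Primrec.const 2))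
    (Primrec.const 0)).and ((Primrec.eq.comp Primrec.fst (Primrec.const [])).or ?_)).or
      ((Primrec.eq (α := ℕ)).exists_mem_list.comp Primrec.fst Primrec.snd)
  exact (PrimrecRel.exists_mem_list (R := fun a b : ℕ => b ≤ a)
    (Primrec.nat_le.comp Primrec.snd Primrec.fst)).comp Primrec.fst Primrec.snd

theorem mem_update {l : List ℕ} {d : Datum} {v : ℕ} :
    v ∈ update l d ↔ v ∈ l ∨ v % 2 = 1 ∧ d = some v := by
  rcases d with _ | w
  · simp [update]
  · simp only [update, Option.elim_some, exists_eq_right, Option.some.injEq]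
    split_ifs with h
    · constructor
      · exact Or.inl
      · rintro (h1 | ⟨h1, rfl⟩)
        · exact h1
        · exact h.resolve_left (by omega)
    · rw [List.mem_cons]
      constructor
      · rintro (rfl | h1)
        · exact Or.inr ⟨by omega, rfl⟩
        · exact Or.inl h1
      · rintro (h1 | ⟨-, rfl⟩)
        · exact Or.inr h1
        · exact Or.inl rfl

theorem mem_foldl_update {σ : List Datum} {v : ℕ} :
    v ∈ σ.foldl update [] ↔ v % 2 = 1 ∧ v ∈ listContent σ := by
  induction σ using List.reverseRecOn with
  | nil => simp [listContent]
  | append_singleton σ d ih =>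
    rw [List.foldl_append, listContent_append, List.foldl_cons, List.foldl_nil, mem_update, ih]
    have : v ∈ listContent [d] ↔ d = some v := by
      simp [listContent, eq_comm]
    rw [Set.mem_union, this]
    tauto

/-- The learner lists the odd numbers in the order of their arrival, so its final state is
determined only up to the order of the entries. -/
theorem lang_eq_of_mem_iff {l l' : List ℕ} (h : ∀ v, v ∈ l ↔ v ∈ l') : lang l = lang l' := by
  have h1 : l = [] ↔ l' = [] := by
    simp only [List.eq_nil_iff_forall_not_mem, h]
  ext v
  simp only [lang, Set.mem_ofPred_eq, h, h1]

theorem odd_mem_lang {l : List ℕ} {v : ℕ} (hv : v % 2 = 1) : v ∈ lang l ↔ v ∈ l := by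
  simp [lang, hv]

theorem foldl_update_take_subset {T : Text} {l : List ℕ} (hT : T.content = lang l) (t : ℕ) :
    (T.take t).foldl update [] ⊆ l := by
  intro v hv
  rw [mem_foldl_update] at hv
  exact (odd_mem_lang hv.1).1 (hT ▸ T.listContent_take_subset t hv.2)

theorem foldl_update_append_of_subset {σ τ : List Datum}
    (h : ∀ v ∈ listContent τ, v % 2 = 1 → v ∈ σ.foldl update []) :
    (σ ++ τ).foldl update [] = σ.foldl update [] := by
  induction τ using List.reverseRecOn with
  | nil => simp
  | append_singleton τ d ih =>
    rw [← List.append_assoc, List.foldl_append, ih fun v hv => h v (by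
      simpa [listContent] using! Or.inl hv)]
    rcases d with _ | w
    · rfl
    · simp only [List.foldl_cons, List.foldl_nil, update, Option.elim_some, exists_eq_right]
      rw [if_pos]
      rcases Nat.mod_two_eq_zero_or_one w with h1 | h1
      · exact Or.inl h1
      · exact Or.inr (h w (by simp [listContent]) h1)

theorem foldl_update_converges {T : Text} {l : List ℕ} (hl : ∀ a ∈ l, a % 2 = 1)
    (hT : T.content = lang l) :
    ∃ t₀ s, lang s = T.content ∧ ∀ t, t₀ ≤ t → (T.take t).foldl update [] = s := by
  have h1 : ∀ v ∈ l, ∃ i, T i = some v := fun v hv => by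
    have : v ∈ T.content := hT ▸ (odd_mem_lang (hl v hv)).2 hv
    exact this
  choose! i hi using h1
  obtain ⟨B, hB⟩ := (l.toFinset.image i).bddAbove
  have h2 : ∀ v ∈ l, v ∈ (T.take (B + 1)).foldl update [] := fun v hv =>
    mem_foldl_update.2 ⟨hl v hv, Text.mem_take.2
      ⟨i v, Nat.lt_succ_of_le (hB (by simpa using ⟨v, hv, rfl⟩)), hi v hv⟩⟩
  refine ⟨B + 1, (T.take (B + 1)).foldl update [], ?_, fun t ht => ?_⟩
  · rw [hT]
    exact lang_eq_of_mem_iff fun v => ⟨fun h => foldl_update_take_subset hT _ h, h2 v⟩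
  · obtain ⟨n, rfl⟩ := Nat.exists_eq_add_of_le ht
    rw [Text.take_add]
    refine foldl_update_append_of_subset fun v hv hv' => h2 v ?_
    refine (odd_mem_lang hv').1 (hT ▸ ?_)
    obtain ⟨i, -, hi⟩ := Text.mem_take.1 hv
    exact ⟨_, hi⟩

/-- All languages `lang l` where `l` is a list of odd numbers. -/
def collection : Set (Set ℕ) := {K | ∃ l : List ℕ, (∀ a ∈ l, a % 2 = 1) ∧ lang l = K}

/-- The languages `lang l` where `l` is a list of at most one odd number. -/
def smallCollection : Set (Set ℕ) :=
  {K | ∃ l : List ℕ, (∀ a ∈ l, a % 2 = 1) ∧ l.length ≤ 1 ∧ lang l = K}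

/-! ### Collecting odd numbers: the positive results -/

variable {φ : ℕ → ℕ →. ℕ}

theorem collection_mem_conservative (hφ : AcceptableSystem φ) :
    collection ∈ TxtBMSEx φ Conservative := by
  refine mem_txtBMSEx_of_transition hφ primrec_update.to_comp (s₀ := []) (by simp)
    rePred_lang ?_ ?_ ?_
  · rintro K ⟨l, -, h⟩
    exact ⟨l, h⟩
  · rintro T ⟨l, hl, h⟩
    exact foldl_update_converges hl h.symm
  · rintro T - M c hc hM s t p q hst hp hq hsub
    rw [hM s p hp, hM t q hq]
    rw [hM s p hp, hc] at hsub
    obtain ⟨n, rfl⟩ := Nat.exists_eq_add_of_le hst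
    rw [Text.take_add, foldl_update_append_of_subset]
    intro v hv hv'
    -- Consistency of the old conjecture with the new data means that every odd number seen since is
    -- already listed, so that the state has not changed.
    refine (odd_mem_lang hv').1 (hsub ?_)
    rw [Text.take_add, listContent_append]
    exact Or.inr hv

theorem smallCollection_mem_monotonic (hφ : AcceptableSystem φ) :
    smallCollection ∈ TxtBMSEx φ Monotonic := by
  refine mem_txtBMSEx_of_transition hφ primrec_update.to_comp (s₀ := []) (by simp)
    rePred_lang ?_ ?_ ?_
  · rintro K ⟨l, -, -, h⟩
    exact ⟨l, h⟩
  · rintro T ⟨l, hl, -, h⟩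
    exact foldl_update_converges hl h.symm
  · rintro T ⟨l, hl, hlen, hT⟩ M c hc hM s t p q hst hp hq v
    rw [hM s p hp, hM t q hq, hc, hc]
    have hsl := foldl_update_take_subset hT.symm s
    have htl := foldl_update_take_subset hT.symm t
    have hmono : ∀ v, v ∈ (T.take s).foldl update [] → v ∈ (T.take t).foldl update [] := by
      intro v
      rw [mem_foldl_update, mem_foldl_update]
      rintro ⟨h1, h2⟩
      obtain ⟨i, hi, h⟩ := Text.mem_take.1 h2
      exact ⟨h1, Text.mem_take.2 ⟨i, by omega, h⟩⟩
    rintro ⟨hv, hvT⟩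
    refine ⟨?_, hvT⟩
    -- Without an odd number at time `t` there was none at time `s`, and the conjectures agree.
    -- Otherwise the only odd number of the target has been found, and the conjecture is the whole
    -- target.
    by_cases h : (T.take t).foldl update [] = []
    · rwa [lang_eq_of_mem_iff (l' := (T.take s).foldl update [])]
      intro v
      exact ⟨fun h1 => by simp [h] at h1, hmono v⟩
    · have : lang ((T.take t).foldl update []) = lang l := by
        refine lang_eq_of_mem_iff fun v => ⟨fun h => htl h, fun hv => ?_⟩
        obtain ⟨a, ha⟩ := List.exists_mem_of_ne_nil _ h
        have ha' := htl ha
        match l, hlen with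
        | [b], _ => simp_all
      rw [this, hT]
      exact hvT

/-! ### Giving up even numbers: the negative results -/

theorem lang_nil : lang [] = {v | v % 2 = 0} := by
  ext v; simp [lang]

theorem exists_listContent_le {σ : List Datum} : ∃ n, ∀ v ∈ listContent σ, v ≤ n := by
  induction σ with
  | nil => exact ⟨0, by simp [listContent]⟩
  | cons d σ ih =>
    obtain ⟨n, hn⟩ := ih
    refine ⟨max n (d.getD 0), fun v hv => ?_⟩
    rcases List.mem_cons.1 hv with rfl | h
    · simp
    · exact le_max_of_le_left (hn v h)

/-- A learner that identifies the even numbers can be led to conjecture them before it is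
presented the language of a large odd number. -/
theorem exists_two_hypotheses {M : Learner}
    (h₀ : ∀ T : Text, T.content = lang [] → LearnsEx φ M T)
    (h₁ : ∀ n, ∀ T : Text, T.content = lang [2 * n + 1] → LearnsEx φ M T) :
    ∃ n, ∃ T : Text, T.content = lang [2 * n + 1] ∧ ∃ s t p q, s ≤ t ∧
      some p ∈ M (T.take s) ∧ some q ∈ M (T.take t) ∧
      langOf φ p = lang [] ∧ langOf φ q = lang [2 * n + 1] := by
  obtain ⟨-, s, p, hp, hpL, -⟩ := h₀ _ (Text.content_ofSet _)
  set σ := (Text.ofSet (lang [])).take s with hσ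
  have hlen : σ.length = s := Text.length_take _ _
  obtain ⟨n, hn⟩ := exists_listContent_le (σ := σ)
  have hsub : listContent σ ⊆ lang [2 * n + 1] := by
    intro v hv
    have h1 := Text.listContent_take_subset _ _ hv
    rw [Text.content_ofSet, lang_nil] at h1
    exact Or.inl ⟨h1, Or.inr ⟨_, List.mem_singleton_self _, by have := hn v hv; omega⟩⟩
  have hT := Text.content_prepend_ofSet hsub
  have hTs : (Text.prepend σ (Text.ofSet (lang [2 * n + 1]))).take s = σ := by
    rw [← hlen]; exact Text.take_prepend_length _ _
  obtain ⟨-, t, q, hq, hqL, hlast⟩ := h₁ n _ hT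
  rw [hT] at hqL
  refine ⟨n, _, hT, s, t, p, q, ?_, by rwa [hTs], hq, by rw [hpL, Text.content_ofSet], hqL⟩
  -- If the final hypothesis for the cut-off language had come before time `s`, then `p` would equal
  -- it, although `2 * n + 1` is not even.
  by_contra hst
  have h2 := hlast s (by omega) p (by rwa [hTs])
  rw [← h2, hpL, Text.content_ofSet] at hqL
  have h3 : 2 * n + 1 ∈ lang [] := hqL ▸ (odd_mem_lang (by omega)).2 (List.mem_singleton_self _)
  rw [odd_mem_lang (by omega)] at h3
  simp at h3

theorem smallCollection_notMem_stronglyMonotonic :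
    smallCollection ∉ TxtBMSEx φ StronglyMonotonic := by
  rintro ⟨-, M, hM⟩
  have hmem₀ : lang [] ∈ smallCollection := ⟨[], by simp, by simp, rfl⟩
  have hmem₁ : ∀ n, lang [2 * n + 1] ∈ smallCollection := fun n =>
    ⟨_, by simp, by simp, rfl⟩
  obtain ⟨n, T, hT, s, t, p, q, hst, hp, hq, hpL, hqL⟩ := exists_two_hypotheses
    (φ := φ) (M := M.hyp) (fun T hT => (hM _ hmem₀ T hT).2.2)
    (fun n T hT => (hM _ (hmem₁ n) T hT).2.2)
  have h := (hM _ (hmem₁ n) T hT).2.1 s t p q hst hp hq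
  rw [hpL, hqL, lang_nil] at h
  have h1 : 2 * n + 2 ∈ lang [2 * n + 1] := h (show (2 * n + 2) % 2 = 0 by omega)
  simp [lang] at h1

theorem collection_notMem_monotonic : collection ∉ TxtBMSEx φ Monotonic := by
  rintro ⟨-, M, hM⟩
  have hmem₀ : lang [] ∈ collection := ⟨[], by simp, rfl⟩
  have hmem₁ : ∀ n, lang [2 * n + 1] ∈ collection := fun n => ⟨_, by simp, rfl⟩
  obtain ⟨n, T, hT, s, t, p, q, hst, hp, hq, hpL, hqL⟩ := exists_two_hypotheses
    (φ := φ) (M := M.hyp) (fun T hT => (hM _ hmem₀ T hT).2.2)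
    (fun n T hT => (hM _ (hmem₁ n) T hT).2.2)
  have hsub : listContent (T.take t) ⊆ lang [2 * n + 1, 2 * n + 3] := by
    intro v hv
    have := T.listContent_take_subset t hv
    rw [hT] at this
    simp only [lang, Set.mem_ofPred_eq, List.mem_cons, List.not_mem_nil, or_false, exists_eq_left,
      exists_eq_or_imp, reduceCtorEq, false_or] at this ⊢
    omega
  have hT' := Text.content_prepend_ofSet hsub
  have hmem₂ : lang [2 * n + 1, 2 * n + 3] ∈ collection := by
    refine ⟨_, ?_, rfl⟩
    simp only [List.mem_cons, List.not_mem_nil, or_false]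
    omega
  have htake : ∀ r ≤ t, (Text.prepend (T.take t) (Text.ofSet (lang [2 * n + 1, 2 * n + 3]))).take r
      = T.take r := by
    intro r hr
    refine List.map_congr_left fun i hi => ?_
    have : i < t := by have := List.mem_range.1 hi; omega
    simp [Text.prepend, Text.take, this]
  have h := (hM _ hmem₂ _ hT').2.1 s t p q hst (by rwa [htake s hst]) (by rwa [htake t le_rfl])
  rw [hpL, hqL, hT', lang_nil] at h
  -- The even number `2 * n + 2` belongs to the target because of `2 * n + 3`, but it lies above the
  -- cut-off of the second conjecture.
  have h1 : 2 * n + 2 ∈ lang [2 * n + 1] := (h (a := 2 * n + 2) ⟨show (2 * n + 2) % 2 = 0 by omega,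
    Or.inl ⟨by omega, Or.inr ⟨2 * n + 3, by simp, by omega⟩⟩⟩).1
  simp [lang] at h1

end OddBounds

/-! ### Conjunctions and disjunctions of recursively enumerable predicates -/

section RecursivelyEnumerable

variable {α : Type*} [Primcodable α]

theorem REPred.and {p q : α → Prop} (hp : REPred p) (hq : REPred q) :
    REPred fun a => p a ∧ q a := by
  obtain ⟨R, hR, h⟩ := hp.exists_primrec
  obtain ⟨R', hR', h'⟩ := hq.exists_primrec
  have hu : Primrec fun a : α × ℕ => a.2.unpair := Primrec.unpair.comp Primrec.snd
  have h1 : Primrec₂ fun a s => R a (Nat.unpair s).1 && R' a (Nat.unpair s).2 :=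
    Primrec.and.comp (hR.comp Primrec.fst (Primrec.fst.comp hu))
      (hR'.comp Primrec.fst (Primrec.snd.comp hu))
  refine h1.re_exists.of_eq fun a => ?_
  rw [h, h']
  constructor
  · rintro ⟨s, hs⟩
    rw [Bool.and_eq_true] at hs
    exact ⟨⟨_, hs.1⟩, ⟨_, hs.2⟩⟩
  · rintro ⟨⟨s, hs⟩, ⟨t, ht⟩⟩
    exact ⟨Nat.pair s t, by simp [hs, ht]⟩

theorem REPred.or {p q : α → Prop} (hp : REPred p) (hq : REPred q) :
    REPred fun a => p a ∨ q a := by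
  obtain ⟨R, hR, h⟩ := hp.exists_primrec
  obtain ⟨R', hR', h'⟩ := hq.exists_primrec
  have h1 : Primrec₂ fun a s => R a s || R' a s := Primrec.or.comp hR hR'
  refine h1.re_exists.of_eq fun a => ?_
  simp only [h, h', Bool.or_eq_true, exists_or]

end RecursivelyEnumerable

/-! ### Running learners that are given by codes -/

namespace Diagonal

/-- One step of the learner with code `k`: the new state and the output. -/
def step (k : Code) (q : ℕ) (d : Datum) : Part (ℕ × Output) :=
  (k.eval (encode (q, d))).bind fun n => Part.ofOption (decode n)

theorem partrec_step : Partrec fun a : Code × ℕ × Datum => step a.1 a.2.1 a.2.2 :=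
  (Nat.Partrec.Code.eval_part.comp Computable.fst
    (Computable.encode.comp Computable.snd)).bind
    (Computable.ofOption (Computable.decode.comp Computable.snd)).to₂

theorem exists_code_step (M : BMSLearner) :
    ∃ k : Code, ∀ q d, step k q d = (M.s q d).bind fun q' => (M.h q d).map fun o => (q', o) := by
  have h : Partrec fun a : ℕ × Datum =>
      (M.s a.1 a.2).bind fun q' => (M.h a.1 a.2).map fun o => (q', o) := by
    refine Partrec.bind M.s_partrec ?_
    exact Partrec.map (M.h_partrec.comp (Computable.fst.comp Computable.fst)
      (Computable.snd.comp Computable.fst))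
      ((Computable.snd.comp Computable.fst).pair Computable.snd).to₂
  obtain ⟨k, hk⟩ := Nat.Partrec.Code.exists_code.1 h
  refine ⟨k, fun q d => ?_⟩
  have h1 := congrFun hk (encode (q, d))
  simp only [encodek, Part.coe_some, Part.bind_some] at h1
  rw [step, h1]
  generalize ((M.s q d).bind fun q' => (M.h q d).map fun o => (q', o)) = p
  rw [Part.bind_map]
  simp only [encodek, Part.ofOption]
  exact Part.bind_some_right p

/-- A step of the learner with code `k`, recording the latest proper output. -/
def stepLatest (k : Code) (r : ℕ × Output) (d : Datum) : Part (ℕ × Output) :=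
  (step k r.1 d).map fun a => (a.1, a.2 <|> r.2)

/-- The state after reading `l` from state `r.1`, and the latest proper output, which is taken
to be `r.2` at the beginning. -/
def run (k : Code) (r : ℕ × Output) (l : List Datum) : Part (ℕ × Output) :=
  l.foldl (fun p d => p.bind fun r => stepLatest k r d) (Part.some r)

theorem run_nil (k : Code) (r : ℕ × Output) : run k r [] = Part.some r := rfl

theorem run_append_singleton (k : Code) (r : ℕ × Output) (l : List Datum) (d : Datum) :
    run k r (l ++ [d]) = (run k r l).bind fun r => stepLatest k r d := by
  simp [run]

theorem run_append (k : Code) (r : ℕ × Output) (l l' : List Datum) :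
    run k r (l ++ l') = (run k r l).bind fun r => run k r l' := by
  induction l' using List.reverseRecOn with
  | nil => simp [run_nil]
  | append_singleton l' d ih =>
    rw [← List.append_assoc, run_append_singleton, ih, Part.bind_assoc]
    simp only [run_append_singleton]

theorem partrec_run {α : Type*} [Primcodable α] {k : α → Code} {r : α → ℕ × Output}
    {l : α → List Datum} (hk : Computable k) (hr : Computable r) (hl : Computable l) :
    Partrec fun a => run (k a) (r a) (l a) := by
  have hstep : Partrec₂ fun (a : α) (y : ℕ × (ℕ × Output)) =>
      (Part.ofOption (l a)[y.1]?).bind fun d => stepLatest (k a) y.2 d := by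
    refine Partrec.bind (Computable.ofOption (Primrec.list_getElem?.to_comp.comp
      (hl.comp Computable.fst) (Computable.fst.comp Computable.snd))) ?_
    refine Partrec.map (partrec_step.comp (f := fun a : Code × ℕ × Datum => step a.1 a.2.1 a.2.2)
      (g := fun b : (α × ℕ × ℕ × Output) × Datum => (k b.1.1, b.1.2.2.1, b.2))
      ((hk.comp (Computable.fst.comp Computable.fst)).pair
        ((Computable.fst.comp (Computable.snd.comp (Computable.snd.comp Computable.fst))).pair
          Computable.snd))) ?_
    exact (Computable.fst.comp Computable.snd).pair (Primrec.option_orElse.to_comp.comp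
      (Computable.snd.comp Computable.snd)
      (Computable.snd.comp (Computable.snd.comp (Computable.snd.comp
        (Computable.fst.comp Computable.fst)))))
  have h := Partrec.nat_rec (Primrec.list_length.to_comp.comp hl) hr.partrec hstep
  refine h.of_eq fun a => ?_
  -- The recursion reads the list by position; after `n` rounds it has processed the first `n` data.
  have h1 : ∀ n ≤ (l a).length, (Nat.rec (Part.some (r a)) (fun y IH => IH.bind fun i =>
      (Part.ofOption (l a)[y]?).bind fun d => stepLatest (k a) i d) n : Part (ℕ × Output)) =
      run (k a) (r a) ((l a).take n) := by
    intro n hn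
    induction n with
    | zero => rfl
    | succ n ih =>
      have h2 : (l a)[n]? = some (l a)[n] := List.getElem?_eq_getElem (by omega)
      rw [List.take_add_one, h2, Option.toList_some, run_append_singleton, ← ih (by omega)]
      simp [h2]
  simpa using! h1 _ le_rfl

/-! ### Tagged data -/

/-- The marks: a finite set of numbers of plain elements, and a bit. -/
abbrev Mark : Type := List ℕ × Bool

/-- The plain element with number `i` of the languages for the code `k`. -/
def plain (k : Code) (i : ℕ) : ℕ := encode (k, (Sum.inl i : ℕ ⊕ Mark))

/-- The marking element `w` of the languages for the code `k`. -/
def mark (k : Code) (w : Mark) : ℕ := encode (k, (Sum.inr w : ℕ ⊕ Mark))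

theorem plain_inj {k : Code} {i j : ℕ} : plain k i = plain k j ↔ i = j := by
  simp [plain]

theorem mark_inj {k : Code} {w w' : Mark} : mark k w = mark k w' ↔ w = w' := by
  simp [mark]

theorem plain_ne_mark {k : Code} {i : ℕ} {w : Mark} : plain k i ≠ mark k w := by
  simp only [plain, mark, ne_eq, encode_inj, Prod.mk.injEq, reduceCtorEq, and_false,
    not_false_eq_true]

theorem primrec_plain : Primrec₂ plain :=
  Primrec.encode.comp (Primrec.fst.pair (Primrec.sumInl.comp Primrec.snd))

theorem primrec_mark : Primrec₂ mark :=
  Primrec.encode.comp (Primrec.fst.pair (Primrec.sumInr.comp Primrec.snd))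

/-- The plain elements with numbers in `l`, as data. -/
def plains (k : Code) (l : List ℕ) : List Datum := l.map fun i => some (plain k i)

/-- The mark `w`, followed by `n` pauses. -/
def markPauses (k : Code) (w : Mark) (n : ℕ) : List Datum :=
  some (mark k w) :: (List.range n).map fun _ => none

theorem primrec_plains : Primrec₂ plains :=
  Primrec.list_map Primrec.snd
    (Primrec.option_some.comp (primrec_plain.comp (Primrec.fst.comp Primrec.fst) Primrec.snd)).to₂

/-! ### Plain elements that lead to new states -/

theorem rePred_newState : REPred fun a : (Code × List ℕ) × (ℕ × ℕ) =>
    ∃ r ∈ step a.1.1 a.1.2.headI (some (plain a.1.1 a.2.1)),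
      r.1 = a.2.2 ∧ ¬ ∃ v ∈ a.1.2, v = a.2.2 := by
  refine Partrec.exists_mem (f := fun a : (Code × List ℕ) × (ℕ × ℕ) =>
    step a.1.1 a.1.2.headI (some (plain a.1.1 a.2.1)))
    (p := fun b => b.2.1 = b.1.2.2 ∧ ¬ ∃ v ∈ b.1.1.2, v = b.1.2.2) ?_ ?_
  · have hk : Computable fun a : (Code × List ℕ) × (ℕ × ℕ) => a.1.1 :=
      Computable.fst.comp Computable.fst
    exact partrec_step.comp (f := fun a : Code × ℕ × Datum => step a.1 a.2.1 a.2.2)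
      (g := fun a : (Code × List ℕ) × (ℕ × ℕ) =>
        (a.1.1, a.1.2.headI, some (plain a.1.1 a.2.1)))
      (hk.pair ((Primrec.list_headI.to_comp.comp (Computable.snd.comp Computable.fst)).pair
        (Computable.option_some.comp (primrec_plain.to_comp.comp hk
          (Computable.fst.comp Computable.snd)))))
  · have hq : Primrec fun b : ((Code × List ℕ) × (ℕ × ℕ)) × (ℕ × Output) => b.1.2.2 :=
      Primrec.snd.comp (Primrec.snd.comp Primrec.fst)
    exact (Primrec.eq.comp (Primrec.fst.comp Primrec.snd) hq).and
      ((Primrec.eq (α := ℕ)).exists_mem_list.comp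
        (Primrec.snd.comp (Primrec.fst.comp Primrec.fst)) hq).not

/-- Finds a plain element that takes the learner with code `k` from state `vs.headI` to a state
that is not in `vs`, together with that state. -/
noncomputable def newState : Code × List ℕ →. ℕ × ℕ := rePred_newState.exists_select.choose

theorem partrec_newState : Partrec newState := rePred_newState.exists_select.choose_spec.1

theorem newState_spec {k : Code} {vs : List ℕ} {i q : ℕ} (h : (i, q) ∈ newState (k, vs)) :
    (∃ o, (q, o) ∈ step k vs.headI (some (plain k i))) ∧ q ∉ vs := by
  obtain ⟨⟨q', o⟩, hr, rfl, h2⟩ := rePred_newState.exists_select.choose_spec.2.1 _ _ h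
  exact ⟨⟨o, hr⟩, by simpa using h2⟩

theorem newState_dom {k : Code} {vs : List ℕ} {i q : ℕ} {o : Output}
    (h : (q, o) ∈ step k vs.headI (some (plain k i))) (hq : q ∉ vs) : (newState (k, vs)).Dom :=
  rePred_newState.exists_select.choose_spec.2.2 (k, vs) (i, q) ⟨_, h, rfl, by simpa using hq⟩

/-- A sequence of `j` plain elements that lead to new states, together with these states. -/
noncomputable def chain (k : Code) (j : ℕ) : Part (List ℕ × List ℕ) :=
  Nat.rec (Part.some ([], [0])) (fun _ IH => IH.bind fun r =>
    (newState (k, r.2)).map fun a => (r.1 ++ [a.1], a.2 :: r.2)) j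

theorem partrec_chain : Partrec₂ chain := by
  have hn : Partrec fun b : (Code × ℕ) × ℕ × List ℕ × List ℕ => newState (b.1.1, b.2.2.2) :=
    partrec_newState.comp ((Computable.fst.comp Computable.fst).pair
      (Computable.snd.comp (Computable.snd.comp Computable.snd)))
  have hr : Computable fun b : ((Code × ℕ) × ℕ × List ℕ × List ℕ) × ℕ × ℕ => b.1.2.2 :=
    Computable.snd.comp (Computable.snd.comp Computable.fst)
  have hc : Computable fun b : ((Code × ℕ) × ℕ × List ℕ × List ℕ) × ℕ × ℕ =>
      (b.1.2.2.1 ++ [b.2.1], b.2.2 :: b.1.2.2.2) :=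
    (Primrec.list_concat.to_comp.comp (Computable.fst.comp hr)
      (Computable.fst.comp Computable.snd)).pair
      (Primrec.list_cons.to_comp.comp (Computable.snd.comp Computable.snd)
        (Computable.snd.comp hr))
  exact Partrec.nat_rec Computable.snd
    (Computable.const (([], [0]) : List ℕ × List ℕ)).partrec (hn.map hc.to₂).to₂

theorem chain_succ (k : Code) (j : ℕ) : chain k (j + 1) = (chain k j).bind fun r =>
    (newState (k, r.2)).map fun a => (r.1 ++ [a.1], a.2 :: r.2) := rfl

/-! ### Reactions -/

/-- The results of running the learner with code `k` on `w.1`, the mark `w` and `n₁` pauses, on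
the same with `n₂` pauses, and on the first `m` plain elements after the former. -/
def reactionRuns (k : Code) (w : Mark) (n₁ n₂ m : ℕ) :
    Part ((ℕ × Output) × (ℕ × Output) × (ℕ × Output)) :=
  (run k (0, none) (plains k w.1)).bind fun r₀ =>
    (run k (r₀.1, none) (markPauses k w n₁)).bind fun r₁ =>
      (run k (r₀.1, none) (markPauses k w n₂)).bind fun r₂ =>
        (run k r₁ (plains k (List.range m))).map fun r₃ => (r₁, r₂, r₃)

/-- The learner with code `k` gets into a loop on `w.1`, the mark `w` and pauses, and puts out
another hypothesis when it is presented the first `m` plain elements in this loop. -/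
def Reaction (k : Code) (w : Mark) (m : ℕ) : Prop :=
  ∃ n₁ n₂, n₁ < n₂ ∧ ∃ r ∈ reactionRuns k w n₁ n₂ m,
    r.1 = r.2.1 ∧ r.1.2 ≠ none ∧ r.2.2.2 ≠ r.1.2

theorem primrec_markPauses : Primrec fun a : Code × Mark × ℕ => markPauses a.1 a.2.1 a.2.2 :=
  Primrec.list_cons.comp (Primrec.option_some.comp (primrec_mark.comp
    Primrec.fst (Primrec.fst.comp Primrec.snd)))
    (Primrec.list_map (Primrec.list_range.comp (Primrec.snd.comp Primrec.snd))
      (Primrec.const (none : Datum)).to₂)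

theorem partrec_reactionRuns :
    Partrec fun a : Code × Mark × ℕ × ℕ × ℕ =>
      reactionRuns a.1 a.2.1 a.2.2.1 a.2.2.2.1 a.2.2.2.2 := by
  have hk : Computable fun a : Code × Mark × ℕ × ℕ × ℕ => a.1 := Computable.fst
  have hw : Computable fun a : Code × Mark × ℕ × ℕ × ℕ => a.2.1 :=
    Computable.fst.comp Computable.snd
  have h₁ : Computable fun a : Code × Mark × ℕ × ℕ × ℕ => a.2.2.1 :=
    Computable.fst.comp (Computable.snd.comp Computable.snd)
  have h₂ : Computable fun a : Code × Mark × ℕ × ℕ × ℕ => a.2.2.2.1 :=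
    Computable.fst.comp (Computable.snd.comp (Computable.snd.comp Computable.snd))
  have hm : Computable fun a : Code × Mark × ℕ × ℕ × ℕ => a.2.2.2.2 :=
    Computable.snd.comp (Computable.snd.comp (Computable.snd.comp Computable.snd))
  have hp₁ : Computable fun a : Code × Mark × ℕ × ℕ × ℕ => markPauses a.1 a.2.1 a.2.2.1 :=
    Computable.comp (f := fun a : Code × Mark × ℕ => markPauses a.1 a.2.1 a.2.2)
      (g := fun a : Code × Mark × ℕ × ℕ × ℕ => (a.1, a.2.1, a.2.2.1))
      primrec_markPauses.to_comp (hk.pair (hw.pair h₁))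
  have hp₂ : Computable fun a : Code × Mark × ℕ × ℕ × ℕ => markPauses a.1 a.2.1 a.2.2.2.1 :=
    Computable.comp (f := fun a : Code × Mark × ℕ => markPauses a.1 a.2.1 a.2.2)
      (g := fun a : Code × Mark × ℕ × ℕ × ℕ => (a.1, a.2.1, a.2.2.2.1))
      primrec_markPauses.to_comp (hk.pair (hw.pair h₂))
  have s₀ : Partrec fun a : Code × Mark × ℕ × ℕ × ℕ => run a.1 (0, none) (plains a.1 a.2.1.1) :=
    partrec_run hk (Computable.const _)
      (primrec_plains.to_comp.comp hk (Computable.fst.comp hw))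
  have s₁ : Partrec fun b : (Code × Mark × ℕ × ℕ × ℕ) × (ℕ × Output) =>
      run b.1.1 (b.2.1, none) (markPauses b.1.1 b.1.2.1 b.1.2.2.1) :=
    partrec_run (hk.comp Computable.fst)
      ((Computable.fst.comp Computable.snd).pair (Computable.const _)) (hp₁.comp Computable.fst)
  have s₂ : Partrec fun b : ((Code × Mark × ℕ × ℕ × ℕ) × (ℕ × Output)) × (ℕ × Output) =>
      run b.1.1.1 (b.1.2.1, none) (markPauses b.1.1.1 b.1.1.2.1 b.1.1.2.2.2.1) :=
    partrec_run (hk.comp (Computable.fst.comp Computable.fst))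
      ((Computable.fst.comp (Computable.snd.comp Computable.fst)).pair (Computable.const _))
      (hp₂.comp (Computable.fst.comp Computable.fst))
  have s₃ : Partrec fun b : (((Code × Mark × ℕ × ℕ × ℕ) × (ℕ × Output)) × (ℕ × Output)) ×
      (ℕ × Output) => run b.1.1.1.1 b.1.2 (plains b.1.1.1.1 (List.range b.1.1.1.2.2.2.2)) :=
    partrec_run (hk.comp (Computable.fst.comp (Computable.fst.comp Computable.fst)))
      (Computable.snd.comp Computable.fst)
      (primrec_plains.to_comp.comp
        (hk.comp (Computable.fst.comp (Computable.fst.comp Computable.fst)))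
        (Primrec.list_range.to_comp.comp
          (hm.comp (Computable.fst.comp (Computable.fst.comp Computable.fst)))))
  have hr : Computable fun c : ((((Code × Mark × ℕ × ℕ × ℕ) × (ℕ × Output)) × (ℕ × Output)) ×
      (ℕ × Output)) × (ℕ × Output) => (c.1.1.2, c.1.2, c.2) :=
    (Computable.snd.comp (Computable.fst.comp Computable.fst)).pair
      ((Computable.snd.comp Computable.fst).pair Computable.snd)
  exact s₀.bind (s₁.bind (s₂.bind (s₃.map hr.to₂).to₂).to₂).to₂

theorem rePred_reaction_aux : REPred fun a : Code × Mark × ℕ × ℕ × ℕ =>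
    ∃ r ∈ reactionRuns a.1 a.2.1 a.2.2.1 a.2.2.2.1 a.2.2.2.2,
      r.1 = r.2.1 ∧ r.1.2 ≠ none ∧ r.2.2.2 ≠ r.1.2 := by
  have hr : Primrec fun c : (Code × Mark × ℕ × ℕ × ℕ) ×
      ((ℕ × Output) × (ℕ × Output) × (ℕ × Output)) => c.2.1 := Primrec.fst.comp Primrec.snd
  have hp : PrimrecPred fun c : (Code × Mark × ℕ × ℕ × ℕ) ×
      ((ℕ × Output) × (ℕ × Output) × (ℕ × Output)) =>
        c.2.1 = c.2.2.1 ∧ c.2.1.2 ≠ none ∧ c.2.2.2.2 ≠ c.2.1.2 :=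
    (Primrec.eq.comp hr (Primrec.fst.comp (Primrec.snd.comp Primrec.snd))).and
      ((Primrec.eq.comp (Primrec.snd.comp hr) (Primrec.const none)).not.and
        (Primrec.eq.comp (Primrec.snd.comp (Primrec.snd.comp (Primrec.snd.comp Primrec.snd)))
          (Primrec.snd.comp hr)).not)
  exact partrec_reactionRuns.exists_mem hp

theorem rePred_reaction : REPred fun a : (Code × Mark) × ℕ => Reaction a.1.1 a.1.2 a.2 := by
  have hg : Computable fun b : ((Code × Mark) × ℕ) × (ℕ × ℕ) =>
      (b.1.1.1, b.1.1.2, b.2.1, b.2.2, b.1.2) :=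
    (Computable.fst.comp (Computable.fst.comp Computable.fst)).pair
      ((Computable.snd.comp (Computable.fst.comp Computable.fst)).pair
        ((Computable.fst.comp Computable.snd).pair ((Computable.snd.comp Computable.snd).pair
          (Computable.snd.comp Computable.fst))))
  have h₁ := rePred_reaction_aux.comp hg
  have h₂ : REPred fun b : ((Code × Mark) × ℕ) × (ℕ × ℕ) => b.2.1 < b.2.2 :=
    (PrimrecPred.computablePred (Primrec.nat_lt.comp (Primrec.fst.comp Primrec.snd)
      (Primrec.snd.comp Primrec.snd))).to_re
  have h₃ := (h₂.and h₁).exists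
  refine h₃.of_eq fun a => ?_
  constructor
  · rintro ⟨⟨n₁, n₂⟩, h⟩
    exact ⟨n₁, n₂, h⟩
  · rintro ⟨n₁, n₂, h⟩
    exact ⟨(n₁, n₂), h⟩

/-- A decidable enumeration of the reactions. -/
noncomputable def reactsAt (a : Code × Mark) (s : ℕ) : Bool :=
  rePred_reaction.exists_primrec.choose (a, s.unpair.1) s.unpair.2

theorem primrec_reactsAt : Primrec₂ reactsAt :=
  rePred_reaction.exists_primrec.choose_spec.1.comp
    (Primrec.fst.pair (Primrec.fst.comp (Primrec.unpair.comp Primrec.snd)))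
    (Primrec.snd.comp (Primrec.unpair.comp Primrec.snd))

/-- A time `s` codes a pair of `m` and a verification time, so that `m ≤ s`. Therefore the plain
elements up to the first such `s`, which `marked` contains, include the `m` elements that cause the
reaction. -/
theorem exists_reaction_of_reactsAt {k : Code} {w : Mark} {s : ℕ}
    (h : reactsAt (k, w) s = true) : ∃ m ≤ s, Reaction k w m :=
  ⟨_, Nat.unpair_left_le s, (rePred_reaction.exists_primrec.choose_spec.2 ((k, w), _)).2 ⟨_, h⟩⟩

theorem exists_reactsAt_of_reaction {k : Code} {w : Mark} {m : ℕ} (h : Reaction k w m) :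
    ∃ s, reactsAt (k, w) s = true := by
  obtain ⟨t, ht⟩ := (rePred_reaction.exists_primrec.choose_spec.2 ((k, w), m)).1 h
  exact ⟨Nat.pair m t, by simpa [reactsAt] using ht⟩

/-- The languages for the code `k`, which also serve as the states of a learner. -/
abbrev Index : Type := Option (Code × Option (Mark × Bool))

/-- The plain elements that occur in the chain for the code `k`. -/
def base (k : Code) : Set ℕ := {v | ∃ i j, ∃ r ∈ chain k j, v = plain k i ∧ i ∈ r.1}

/-- The mark `w`, the plain elements in `w.1`, and further plain elements up to the first
reaction. If there is no reaction, these are all plain elements if `f` is true, and no further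
ones otherwise. -/
def marked (k : Code) (w : Mark) (f : Bool) : Set ℕ :=
  {v | v = mark k w ∨ ∃ i, v = plain k i ∧
    (i ∈ w.1 ∨ (∀ s < i, reactsAt (k, w) s = false) ∧
      (f = true ∨ ∃ s, reactsAt (k, w) s = true))}

/-- The language with a given index. -/
def lang : Index → Set ℕ
  | none => ∅
  | some (k, none) => base k
  | some (k, some (w, f)) => marked k w f

theorem rePred_lang_base : REPred fun a : Index × ℕ =>
    ∃ b : (Code × ℕ × ℕ), (a.1 = some (b.1, none) ∧ a.2 = plain b.1 b.2.1) ∧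
      ∃ r ∈ chain b.1 b.2.2, ∃ i ∈ r.1, i = b.2.1 := by
  have hb : Primrec fun c : (Index × ℕ) × (Code × ℕ × ℕ) => c.2 := Primrec.snd
  have h₁ : PrimrecPred fun c : (Index × ℕ) × (Code × ℕ × ℕ) =>
      c.1.1 = some (c.2.1, none) ∧ c.1.2 = plain c.2.1 c.2.2.1 :=
    (Primrec.eq.comp (Primrec.fst.comp Primrec.fst) (Primrec.option_some.comp
      ((Primrec.fst.comp hb).pair (Primrec.const none)))).and
      (Primrec.eq.comp (Primrec.snd.comp Primrec.fst)
        (primrec_plain.comp (Primrec.fst.comp hb) (Primrec.fst.comp (Primrec.snd.comp hb))))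
  have h₂ : Partrec fun c : (Index × ℕ) × (Code × ℕ × ℕ) => chain c.2.1 c.2.2.2 :=
    Partrec₂.comp partrec_chain (Computable.fst.comp Computable.snd)
      (Computable.snd.comp (Computable.snd.comp Computable.snd))
  have h₃ : PrimrecPred fun d : ((Index × ℕ) × (Code × ℕ × ℕ)) × (List ℕ × List ℕ) =>
      ∃ i ∈ d.2.1, i = d.1.2.2.1 :=
    (Primrec.eq (α := ℕ)).exists_mem_list.comp (Primrec.fst.comp Primrec.snd)
      (Primrec.fst.comp (Primrec.snd.comp (Primrec.snd.comp Primrec.fst)))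
  exact (h₁.computablePred.to_re.and (h₂.exists_mem h₃)).exists

/-- Data from which membership in `marked` can be verified: the code, the mark, the bit, the
number of the element, and a time. -/
abbrev Witness : Type := (Code × Mark) × Bool × ℕ × ℕ

theorem rePred_lang_marked : REPred fun a : Index × ℕ =>
    ∃ b : Witness, a.1 = some (b.1.1, some (b.1.2, b.2.1)) ∧
      (a.2 = mark b.1.1 b.1.2 ∨ a.2 = plain b.1.1 b.2.2.1 ∧
        ((∃ i ∈ b.1.2.1, i = b.2.2.1) ∨ (∀ s < b.2.2.1, reactsAt b.1 s = false) ∧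
          (b.2.1 = true ∨ reactsAt b.1 b.2.2.2 = true))) := by
  have hb : Primrec fun c : (Index × ℕ) × Witness => c.2 := Primrec.snd
  have hk : Primrec fun c : (Index × ℕ) × Witness => c.2.1.1 :=
    Primrec.fst.comp (Primrec.fst.comp hb)
  have hw : Primrec fun c : (Index × ℕ) × Witness => c.2.1.2 :=
    Primrec.snd.comp (Primrec.fst.comp hb)
  have hf : Primrec fun c : (Index × ℕ) × Witness => c.2.2.1 :=
    Primrec.fst.comp (Primrec.snd.comp hb)
  have hi : Primrec fun c : (Index × ℕ) × Witness => c.2.2.2.1 :=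
    Primrec.fst.comp (Primrec.snd.comp (Primrec.snd.comp hb))
  have hs : Primrec fun c : (Index × ℕ) × Witness => c.2.2.2.2 :=
    Primrec.snd.comp (Primrec.snd.comp (Primrec.snd.comp hb))
  have hv : Primrec fun c : (Index × ℕ) × Witness => c.1.2 := Primrec.snd.comp Primrec.fst
  have h₁ : PrimrecPred fun c : (Index × ℕ) × Witness =>
      c.1.1 = some (c.2.1.1, some (c.2.1.2, c.2.2.1)) :=
    Primrec.eq.comp (Primrec.fst.comp Primrec.fst) (Primrec.option_some.comp
      (hk.pair (Primrec.option_some.comp (hw.pair hf))))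
  have h₂ : PrimrecPred fun c : (Index × ℕ) × Witness => c.1.2 = mark c.2.1.1 c.2.1.2 :=
    Primrec.eq.comp hv (primrec_mark.comp hk hw)
  have h₃ : PrimrecPred fun c : (Index × ℕ) × Witness => c.1.2 = plain c.2.1.1 c.2.2.2.1 :=
    Primrec.eq.comp hv (primrec_plain.comp hk hi)
  have h₄ : PrimrecPred fun c : (Index × ℕ) × Witness => ∃ i ∈ c.2.1.2.1, i = c.2.2.2.1 :=
    (Primrec.eq (α := ℕ)).exists_mem_list.comp (Primrec.fst.comp hw) hi
  have h₅ : PrimrecRel fun (s : ℕ) (a : Code × Mark) => reactsAt a s = false :=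
    Primrec.eq.comp (primrec_reactsAt.comp Primrec.snd Primrec.fst) (Primrec.const false)
  have h₆ : PrimrecPred fun c : (Index × ℕ) × Witness =>
      ∀ s < c.2.2.2.1, reactsAt c.2.1 s = false :=
    (h₅.forall_mem_list.comp (Primrec.list_range.comp hi) (Primrec.fst.comp hb)).of_eq
      fun c => by simp only [List.mem_range]
  have h₇ : PrimrecPred fun c : (Index × ℕ) × Witness => c.2.2.1 = true :=
    Primrec.eq.comp hf (Primrec.const true)
  have h₈ : PrimrecPred fun c : (Index × ℕ) × Witness => reactsAt c.2.1 c.2.2.2.2 = true :=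
    Primrec.eq.comp (primrec_reactsAt.comp (Primrec.fst.comp hb) hs) (Primrec.const true)
  exact (h₁.and (h₂.or (h₃.and (h₄.or (h₆.and (h₇.or h₈)))))).computablePred.to_re.exists

theorem rePred_lang : REPred fun a : Index × ℕ => a.2 ∈ lang a.1 := by
  refine (rePred_lang_base.or rePred_lang_marked).of_eq ?_
  rintro ⟨_ | ⟨k, _ | ⟨w, f⟩⟩, v⟩
  · simp [lang]
  · simp only [lang, base, Set.mem_ofPred_eq, Option.some.injEq, Prod.mk.injEq, reduceCtorEq,
      and_false, false_and, exists_false, or_false, exists_eq_right]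
    constructor
    · rintro ⟨⟨k', i, j⟩, ⟨⟨rfl, -⟩, h₁⟩, r, hr, hi⟩
      exact ⟨i, j, r, hr, h₁, hi⟩
    · rintro ⟨i, j, r, hr, h₁, hi⟩
      exact ⟨⟨k, i, j⟩, ⟨⟨rfl, trivial⟩, h₁⟩, r, hr, hi⟩
  · simp only [lang, marked, Set.mem_ofPred_eq, Option.some.injEq, Prod.mk.injEq, reduceCtorEq,
      and_false, false_and, exists_false, false_or, exists_eq_right]
    constructor
    · rintro ⟨⟨⟨k', w'⟩, f', i, s⟩, ⟨rfl, rfl, rfl⟩, h⟩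
      rcases h with h | ⟨h₁, h | ⟨h₂, h⟩⟩
      · exact Or.inl h
      · exact Or.inr ⟨i, h₁, Or.inl h⟩
      · exact Or.inr ⟨i, h₁, Or.inr ⟨h₂, h.imp_right fun h => ⟨s, h⟩⟩⟩
    · rintro (h | ⟨i, h₁, h | ⟨h₂, h | ⟨s, h⟩⟩⟩)
      · exact ⟨((k, w), f, 0, 0), ⟨rfl, rfl, rfl⟩, Or.inl h⟩
      · exact ⟨((k, w), f, i, 0), ⟨rfl, rfl, rfl⟩, Or.inr ⟨h₁, Or.inl h⟩⟩
      · exact ⟨((k, w), f, i, 0), ⟨rfl, rfl, rfl⟩, Or.inr ⟨h₁, Or.inr ⟨h₂, Or.inl h⟩⟩⟩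
      · exact ⟨((k, w), f, i, s), ⟨rfl, rfl, rfl⟩, Or.inr ⟨h₁, Or.inr ⟨h₂, Or.inr h⟩⟩⟩

/-! ### A strongly monotonic learner -/

/-- The transition on a plain element. -/
def updatePlain (s : Index) (k : Code) (i : ℕ) : Index :=
  s.elim (some (k, none)) fun a =>
    a.2.elim s fun b => if ∃ j ∈ b.1.1, j = i then s else some (a.1, some (b.1, true))

/-- The transition on a mark. -/
def updateMark (s : Index) (k : Code) (w : Mark) : Index :=
  s.elim (some (k, some (w, false))) fun a => a.2.elim (some (k, some (w, false))) fun _ => s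

/-- The transition function of the learner: it starts with the empty language, goes on to `base`,
to `marked` when it sees a mark, and to the larger version of `marked` when it sees a plain element
afterwards that is not listed in the mark. -/
def update (s : Index) (d : Datum) : Index :=
  (d.bind fun v => (decode v : Option (Code × (ℕ ⊕ Mark)))).elim s fun a =>
    a.2.elim (updatePlain s a.1) (updateMark s a.1)

theorem primrec_updatePlain : Primrec fun a : Index × Code × ℕ =>
    updatePlain a.1 a.2.1 a.2.2 := by
  have h₀ : Primrec fun a : Index × Code × ℕ => (some (a.2.1, none) : Index) :=
    Primrec.option_some.comp ((Primrec.fst.comp Primrec.snd).pair (Primrec.const none))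
  have hc : PrimrecPred fun c : ((Index × Code × ℕ) × (Code × Option (Mark × Bool))) ×
      (Mark × Bool) => ∃ j ∈ c.2.1.1, j = c.1.1.2.2 :=
    (Primrec.eq (α := ℕ)).exists_mem_list.comp
      (Primrec.fst.comp (Primrec.fst.comp Primrec.snd))
      (Primrec.snd.comp (Primrec.snd.comp (Primrec.fst.comp Primrec.fst)))
  have h₂ : Primrec₂ fun (b : (Index × Code × ℕ) × (Code × Option (Mark × Bool)))
      (m : Mark × Bool) => if ∃ j ∈ m.1.1, j = b.1.2.2 then b.1.1
        else (some (b.2.1, some (m.1, true)) : Index) :=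
    Primrec.ite hc (Primrec.fst.comp (Primrec.fst.comp Primrec.fst))
      (Primrec.option_some.comp ((Primrec.fst.comp (Primrec.snd.comp Primrec.fst)).pair
        (Primrec.option_some.comp ((Primrec.fst.comp Primrec.snd).pair (Primrec.const true)))))
  have h₁ : Primrec₂ fun (a : Index × Code × ℕ) (b : Code × Option (Mark × Bool)) =>
      (b.2.casesOn a.1 fun m => if ∃ j ∈ m.1.1, j = a.2.2 then a.1
        else some (b.1, some (m.1, true)) : Index) :=
    Primrec.option_casesOn (Primrec.snd.comp Primrec.snd) (Primrec.fst.comp Primrec.fst) h₂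
  refine (Primrec.option_casesOn Primrec.fst h₀ h₁).of_eq ?_
  rintro ⟨_ | ⟨k, _ | m⟩, k', i⟩ <;> rfl

theorem primrec_updateMark : Primrec fun a : Index × Code × Mark =>
    updateMark a.1 a.2.1 a.2.2 := by
  have h₀ : Primrec fun a : Index × Code × Mark =>
      (some (a.2.1, some (a.2.2, false)) : Index) :=
    Primrec.option_some.comp ((Primrec.fst.comp Primrec.snd).pair (Primrec.option_some.comp
      ((Primrec.snd.comp Primrec.snd).pair (Primrec.const false))))
  have h₁ : Primrec₂ fun (a : Index × Code × Mark) (b : Code × Option (Mark × Bool)) =>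
      (b.2.casesOn (some (a.2.1, some (a.2.2, false))) fun _ => a.1 : Index) :=
    Primrec.option_casesOn (Primrec.snd.comp Primrec.snd) (h₀.comp Primrec.fst)
      (Primrec.fst.comp (Primrec.fst.comp Primrec.fst)).to₂
  refine (Primrec.option_casesOn Primrec.fst h₀ h₁).of_eq ?_
  rintro ⟨_ | ⟨k, _ | m⟩, k', i⟩ <;> rfl

theorem primrec_update : Primrec₂ update := by
  have hd : Primrec fun a : Index × Datum =>
      a.2.bind fun v => (decode v : Option (Code × (ℕ ⊕ Mark))) :=
    Primrec.option_bind Primrec.snd (Primrec.decode.comp Primrec.snd).to₂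
  have hp : Primrec₂ fun (b : (Index × Datum) × (Code × (ℕ ⊕ Mark))) (i : ℕ) =>
      updatePlain b.1.1 b.2.1 i :=
    Primrec.comp (f := fun a : Index × Code × ℕ => updatePlain a.1 a.2.1 a.2.2)
      (g := fun c : ((Index × Datum) × (Code × (ℕ ⊕ Mark))) × ℕ => (c.1.1.1, c.1.2.1, c.2))
      primrec_updatePlain ((Primrec.fst.comp (Primrec.fst.comp Primrec.fst)).pair
        ((Primrec.fst.comp (Primrec.snd.comp Primrec.fst)).pair Primrec.snd))
  have hm : Primrec₂ fun (b : (Index × Datum) × (Code × (ℕ ⊕ Mark))) (w : Mark) =>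
      updateMark b.1.1 b.2.1 w :=
    Primrec.comp (f := fun a : Index × Code × Mark => updateMark a.1 a.2.1 a.2.2)
      (g := fun c : ((Index × Datum) × (Code × (ℕ ⊕ Mark))) × Mark => (c.1.1.1, c.1.2.1, c.2))
      primrec_updateMark ((Primrec.fst.comp (Primrec.fst.comp Primrec.fst)).pair
        ((Primrec.fst.comp (Primrec.snd.comp Primrec.fst)).pair Primrec.snd))
  refine (Primrec.option_casesOn hd Primrec.fst (Primrec.sumCasesOn
    (Primrec.snd.comp Primrec.snd) hp hm).to₂).of_eq ?_
  rintro ⟨s, d⟩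
  simp only [update]
  rcases d.bind fun v => (decode v : Option (Code × (ℕ ⊕ Mark))) with _ | ⟨k, i | w⟩ <;> rfl

theorem update_plain (s : Index) (k : Code) (i : ℕ) :
    update s (some (plain k i)) = updatePlain s k i := by
  simp only [update, plain, Option.bind_some, encodek, Option.elim_some, Sum.elim_inl]

theorem update_mark (s : Index) (k : Code) (w : Mark) :
    update s (some (mark k w)) = updateMark s k w := by
  simp only [update, mark, Option.bind_some, encodek, Option.elim_some, Sum.elim_inr]

end Diagonal

theorem finite_listContent (σ : List Datum) : (listContent σ).Finite := by
  refine (σ.toFinset.finite_toSet.preimage (Option.some_injective ℕ).injOn).subset fun v hv => ?_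
  simpa [listContent] using! hv

/-! ### Correctness of the strongly monotonic learner -/

namespace Diagonal

theorem marked_mono (k : Code) (w : Mark) : marked k w false ⊆ marked k w true := by
  rintro v (h | ⟨i, h₁, h | ⟨h₂, -⟩⟩)
  · exact Or.inl h
  · exact Or.inr ⟨i, h₁, Or.inl h⟩
  · exact Or.inr ⟨i, h₁, Or.inr ⟨h₂, Or.inl rfl⟩⟩

/-- The learner need not know whether a reaction exists: if there is one, switching the bit changes
only the index, which strong monotonicity permits. -/
theorem marked_eq_of_reactsAt {k : Code} {w : Mark} (h : ∃ s, reactsAt (k, w) s = true)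
    (f f' : Bool) : marked k w f = marked k w f' := by
  simp [marked, h]

theorem mark_mem_marked {k : Code} {w w' : Mark} {f : Bool} :
    mark k w' ∈ marked k w f ↔ w' = w := by
  simp [marked, mark_inj, plain_ne_mark.symm]

theorem plain_mem_marked {k : Code} {w : Mark} {f : Bool} {i : ℕ} :
    plain k i ∈ marked k w f ↔ i ∈ w.1 ∨ (∀ s < i, reactsAt (k, w) s = false) ∧
      (f = true ∨ ∃ s, reactsAt (k, w) s = true) := by
  simp [marked, plain_inj, plain_ne_mark]

/-- The languages for the code `k`: the set `base k`, and the sets `marked k w f` where `w` lists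
the elements of `base k`. -/
def collection : Set (Set ℕ) :=
  {K | ∃ k, K = base k ∨ ∃ w f, base k = {v | ∃ i ∈ w.1, v = plain k i} ∧ K = marked k w f}

theorem base_subset_marked {k : Code} {w : Mark} (h : base k = {v | ∃ i ∈ w.1, v = plain k i})
    (f : Bool) : base k ⊆ marked k w f := by
  rw [h]
  rintro v ⟨i, hi, rfl⟩
  exact plain_mem_marked.2 (Or.inl hi)

/-- The content `C` consists of plain elements and of marks that list `base k`. -/
def IsContent (k : Code) (C : Set ℕ) : Prop :=
  ∀ v ∈ C, (∃ i, v = plain k i) ∨ ∃ w, v = mark k w ∧ base k ⊆ marked k w false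

theorem isContent_base (k : Code) : IsContent k (base k) := by
  rintro v ⟨i, -, -, -, rfl, -⟩
  exact Or.inl ⟨i, rfl⟩

theorem isContent_marked {k : Code} {w : Mark} (h : base k = {v | ∃ i ∈ w.1, v = plain k i})
    (f : Bool) : IsContent k (marked k w f) := by
  rintro v (rfl | ⟨i, rfl, -⟩)
  · exact Or.inr ⟨w, rfl, base_subset_marked h false⟩
  · exact Or.inl ⟨i, rfl⟩

/-- A state that can be reached on data from `C`. -/
def Reachable (k : Code) (C : Set ℕ) : Index → Prop
  | none => True
  | some (k', none) => k' = k
  | some (k', some (w, f)) => k' = k ∧ mark k w ∈ C ∧ (f = true → ∃ i ∉ w.1, plain k i ∈ C)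

/-- The position of a state in every run of the learner. -/
def rank : Index → ℕ
  | none => 0
  | some (_, none) => 1
  | some (_, some (_, false)) => 2
  | some (_, some (_, true)) => 3

theorem rank_le (s : Index) : rank s ≤ 3 := by
  rcases s with _ | ⟨k, _ | ⟨w, _ | _⟩⟩ <;> simp [rank]

theorem updatePlain_eq_or (s : Index) (k : Code) (i : ℕ) :
    updatePlain s k i = s ∨ rank s < rank (updatePlain s k i) := by
  rcases s with _ | ⟨k', _ | ⟨w, _ | _⟩⟩
  · simp [updatePlain, rank]
  · simp [updatePlain]
  · by_cases h : i ∈ w.1 <;> simp [updatePlain, rank, h]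
  · by_cases h : i ∈ w.1 <;> simp [updatePlain, h]

theorem updateMark_eq_or (s : Index) (k : Code) (w : Mark) :
    updateMark s k w = s ∨ rank s < rank (updateMark s k w) := by
  rcases s with _ | ⟨k', _ | ⟨w', _ | _⟩⟩ <;> simp [updateMark, rank]

/-- As `rank` is at most 3, this bounds the number of state changes on any text and yields
convergence. -/
theorem update_eq_or (s : Index) (d : Datum) : update s d = s ∨ rank s < rank (update s d) := by
  unfold update
  rcases d.bind fun v => (decode v : Option (Code × (ℕ ⊕ Mark))) with _ | ⟨k, i | w⟩
  · exact Or.inl rfl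
  · exact updatePlain_eq_or s k i
  · exact updateMark_eq_or s k w

theorem update_spec {k : Code} {C : Set ℕ} (hC : IsContent k C) {s : Index}
    (hs : Reachable k C s) {d : Datum} (hd : ∀ v, d = some v → v ∈ C) :
    Reachable k C (update s d) ∧ lang s ⊆ lang (update s d) := by
  rcases d with _ | v
  · exact ⟨hs, subset_rfl⟩
  have hv := hd v rfl
  rcases hC v hv with ⟨i, rfl⟩ | ⟨w, rfl, hw⟩
  · rw [update_plain]
    rcases s with _ | ⟨k', _ | ⟨w, f⟩⟩
    · exact ⟨rfl, Set.empty_subset _⟩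
    · exact ⟨hs, subset_rfl⟩
    · obtain ⟨rfl, h₁, h₂⟩ := hs
      by_cases h : i ∈ w.1
      · have : updatePlain (some (k', some (w, f))) k' i = some (k', some (w, f)) := by
          simp [updatePlain, h]
        rw [this]
        exact ⟨⟨rfl, h₁, h₂⟩, subset_rfl⟩
      · have : updatePlain (some (k', some (w, f))) k' i = some (k', some (w, true)) := by
          simp [updatePlain, h]
        rw [this]
        refine ⟨⟨rfl, h₁, fun _ => ⟨i, h, hv⟩⟩, ?_⟩
        cases f
        · exact marked_mono k' w
        · exact subset_rfl
  · rw [update_mark]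
    rcases s with _ | ⟨k', _ | ⟨w', f⟩⟩
    · exact ⟨⟨rfl, hv, by simp⟩, Set.empty_subset _⟩
    · obtain rfl : k' = k := hs
      exact ⟨⟨rfl, hv, by simp⟩, hw⟩
    · exact ⟨hs, subset_rfl⟩

/-- The state of the learner after `t` data of the text `T`. -/
def stateAt (T : Text) (t : ℕ) : Index := (T.take t).foldl update none

theorem stateAt_succ (T : Text) (t : ℕ) : stateAt T (t + 1) = update (stateAt T t) (T t) := by
  simp [stateAt, Text.take_succ]

theorem reachable_stateAt {k : Code} {T : Text} (hT : IsContent k T.content) (t : ℕ) :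
    Reachable k T.content (stateAt T t) := by
  induction t with
  | zero => trivial
  | succ t ih =>
    rw [stateAt_succ]
    exact (update_spec hT ih fun v hv => ⟨t, hv⟩).1

theorem lang_stateAt_mono {k : Code} {T : Text} (hT : IsContent k T.content) :
    Monotone fun t => lang (stateAt T t) := by
  refine monotone_nat_of_le_succ fun t => ?_
  rw [stateAt_succ]
  exact (update_spec hT (reachable_stateAt hT t) fun v hv => ⟨t, hv⟩).2

theorem exists_stateAt_eq (T : Text) : ∃ t₀, (∀ t, rank (stateAt T t) ≤ rank (stateAt T t₀)) ∧
    ∀ t, t₀ ≤ t → stateAt T t = stateAt T t₀ := by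
  obtain ⟨t₀, ht₀⟩ : ∃ t₀, ∀ t, rank (stateAt T t) ≤ rank (stateAt T t₀) := by
    have h : (Set.range fun t => rank (stateAt T t)).Finite :=
      (Set.finite_Iic 3).subset (by rintro _ ⟨t, rfl⟩; exact rank_le _)
    obtain ⟨_, ⟨t₀, rfl⟩, h₂⟩ := Set.exists_max_image _ id h ⟨_, 0, rfl⟩
    exact ⟨t₀, fun t => h₂ _ ⟨t, rfl⟩⟩
  refine ⟨t₀, ht₀, fun t ht => ?_⟩
  induction t, ht using Nat.le_induction with
  | base => rfl
  | succ t _ ih =>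
    rw [stateAt_succ]
    rcases update_eq_or (stateAt T t) (T t) with h | h
    · rw [h, ih]
    · have := ht₀ (t + 1)
      rw [stateAt_succ] at this
      rw [ih] at h this
      omega

theorem rank_lt_of_mark_mem {k : Code} {w : Mark} {T : Text} (h : mark k w ∈ T.content) :
    ∃ t, 1 < rank (stateAt T t) := by
  obtain ⟨i, hi⟩ := h
  refine ⟨i + 1, ?_⟩
  rw [stateAt_succ, hi, update_mark]
  rcases stateAt T i with _ | ⟨k', _ | ⟨w', _ | _⟩⟩ <;> simp [updateMark, rank]

theorem rank_pos_of_plain_mem {k : Code} {i : ℕ} {T : Text} (h : plain k i ∈ T.content) :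
    ∃ t, 0 < rank (stateAt T t) := by
  obtain ⟨j, hj⟩ := h
  refine ⟨j + 1, ?_⟩
  rw [stateAt_succ, hj, update_plain]
  rcases stateAt T j with _ | ⟨k', _ | ⟨w', _ | _⟩⟩ <;> simp [updatePlain, rank]
  all_goals split_ifs <;> simp

theorem stateAt_converges {T : Text} (hT : T.content ∈ collection) :
    ∃ t₀ s, lang s = T.content ∧ ∀ t, t₀ ≤ t → stateAt T t = s := by
  obtain ⟨t₀, hrank, hconst⟩ := exists_stateAt_eq T
  refine ⟨t₀, stateAt T t₀, ?_, hconst⟩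
  obtain ⟨k, hk | ⟨w, f, hw, hk⟩⟩ := hT
  · have hC : IsContent k T.content := hk ▸ isContent_base k
    have hreach := reachable_stateAt hC t₀
    generalize stateAt T t₀ = s at hreach hrank
    rcases s with _ | ⟨k', _ | ⟨w, f⟩⟩
    -- Remaining in the initial state is correct only if `base k` is empty; any plain element would
    -- have raised the rank.
    · rw [lang]
      refine (Set.eq_empty_of_forall_notMem fun v hv => ?_).symm
      obtain ⟨i, rfl⟩ : ∃ i, v = plain k i := by
        rw [hk] at hv
        obtain ⟨i, -, -, -, rfl, -⟩ := hv
        exact ⟨i, rfl⟩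
      obtain ⟨t, ht⟩ := rank_pos_of_plain_mem hv
      exact absurd (hrank t) (not_le.2 ht)
    · obtain rfl : k' = k := hreach
      exact hk.symm
    · have h := hreach.2.1
      rw [hk] at h
      obtain ⟨i, -, -, -, h, -⟩ := h
      exact absurd h.symm plain_ne_mark
  · have hC : IsContent k T.content := hk ▸ isContent_marked hw f
    have hreach := reachable_stateAt hC t₀
    obtain ⟨t, ht⟩ := rank_lt_of_mark_mem (k := k) (w := w) (T := T)
      (hk ▸ mark_mem_marked.2 rfl)
    have h1 := lt_of_lt_of_le ht (hrank t)
    rcases hs : stateAt T t₀ with _ | ⟨k', _ | ⟨w', f'⟩⟩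
    · simp [hs, rank] at h1
    · simp [hs, rank] at h1
    · rw [hs] at hreach
      obtain ⟨rfl, h₂, h₃⟩ := hreach
      rw [hk, mark_mem_marked] at h₂
      subst h₂
      rw [lang, hk]
      by_cases hR : ∃ s, reactsAt (k', w') s = true
      · exact marked_eq_of_reactsAt hR _ _
      · match f', f with
        | true, true => rfl
        | false, false => rfl
        | true, false =>
          obtain ⟨i, hi, h⟩ := h₃ rfl
          rw [hk, plain_mem_marked] at h
          exact absurd (h.resolve_left hi).2 (by simpa using hR)
        | false, true =>
          exfalso
          -- The target contains infinitely many plain elements that the mark does not list. All of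
          -- them would have to occur before `t₀`, since a later one would set the bit.
          have hinf : ((plain k') '' {i | i ∉ w'.1}).Infinite := by
            refine Set.Infinite.image (fun i _ j _ h => plain_inj.1 h) ?_
            have := (w'.1.toFinset.finite_toSet).infinite_compl
            refine this.mono fun i hi => ?_
            simpa using hi
          refine hinf ((finite_listContent (T.take t₀)).subset ?_)
          rintro _ ⟨i, hi, rfl⟩
          have hmem : plain k' i ∈ T.content := by
            rw [hk, plain_mem_marked]
            exact Or.inr ⟨fun s _ => by
              by_contra h
              exact hR ⟨s, by simpa using h⟩, Or.inl rfl⟩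
          obtain ⟨j, hj⟩ := hmem
          refine Text.mem_take.2 ⟨j, ?_, hj⟩
          by_contra hjt
          have h4 := hconst (j + 1) (by omega)
          rw [stateAt_succ, hconst j (by omega), hs, hj, update_plain] at h4
          have hi' : i ∉ w'.1 := hi
          simp [updatePlain, hi'] at h4

theorem exists_index_of_mem_collection {K : Set ℕ} (hK : K ∈ collection) : ∃ s, lang s = K := by
  obtain ⟨k, rfl | ⟨w, f, -, rfl⟩⟩ := hK
  · exact ⟨some (k, none), rfl⟩
  · exact ⟨some (k, some (w, f)), rfl⟩

theorem collection_mem_stronglyMonotonic {φ : ℕ → ℕ →. ℕ} (hφ : AcceptableSystem φ) :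
    collection ∈ TxtBMSEx φ StronglyMonotonic := by
  refine mem_txtBMSEx_of_transition hφ primrec_update.to_comp (s₀ := none) (by simp)
    rePred_lang (fun K => exists_index_of_mem_collection) (fun T => stateAt_converges) ?_
  rintro T hT M c hc hM s t p q hst hp hq
  rw [hM s p hp, hM t q hq, hc, hc]
  obtain ⟨k, hk | ⟨w, f, hw, hk⟩⟩ := hT
  · exact lang_stateAt_mono (hk ▸ isContent_base k) hst
  · exact lang_stateAt_mono (hk ▸ isContent_marked hw f) hst

end Diagonal

/-! ### Runs, states and latest outputs of a described learner -/

namespace Text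

theorem take_prepend_of_prefix {σ τ : List Datum} (h : τ <+: σ) (f : Text) :
    (prepend σ f).take τ.length = τ := by
  obtain ⟨ρ, rfl⟩ := h
  apply List.ext_getElem
  · simp [take]
  · intro i h1 h2
    have : i < τ.length + ρ.length := by omega
    simp [take, prepend, this, List.getElem_append_left, h2]

end Text

namespace BMSLearner

variable {M : BMSLearner}

/-- A learner sees its past only through its state. This makes the detours at a dead end invisible.
-/
theorem state_append_congr {l l' : List Datum} {p : ℕ} (h : p ∈ M.state l) (h' : p ∈ M.state l')
    (τ : List Datum) : M.state (l ++ τ) = M.state (l' ++ τ) := by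
  have h₁ : M.state l = M.state l' := by
    rw [Part.eq_some_iff.2 h, Part.eq_some_iff.2 h']
  simp only [state, List.foldl_append] at h₁ ⊢
  rw [h₁]

theorem dom_state_of_learnsEx {φ : ℕ → ℕ →. ℕ} {T : Text} (h : LearnsEx φ M.hyp T) (t : ℕ) :
    (M.state (T.take t)).Dom := by
  have h₁ := h.1 (t + 1)
  rw [Text.take_succ, hyp_append] at h₁
  exact h₁.1

theorem dom_state_of_learnsEx_prepend {φ : ℕ → ℕ →. ℕ} {σ : List Datum} {f : Text}
    (h : LearnsEx φ M.hyp (Text.prepend σ f)) : (M.state σ).Dom := by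
  have h₁ := dom_state_of_learnsEx h σ.length
  rwa [Text.take_prepend_length] at h₁

end BMSLearner

namespace Diagonal

/-- The code `k` describes the learner `M`. -/
def Describes (k : Code) (M : BMSLearner) : Prop :=
  ∀ q d, step k q d = (M.s q d).bind fun q' => (M.h q d).map fun o => (q', o)

variable {k : Code} {M : BMSLearner} {φ : ℕ → ℕ →. ℕ}

theorem Describes.mem_step (hk : Describes k M) {q q' : ℕ} {d : Datum} {o : Output} :
    (q', o) ∈ step k q d ↔ q' ∈ M.s q d ∧ o ∈ M.h q d := by
  simp [hk q d]

theorem Describes.exists_mem_step (hk : Describes k M) {q q' : ℕ} {d : Datum}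
    (h : q' ∈ M.s q d) : ∃ o, (q', o) ∈ step k q d := by
  have h₁ : (M.h q d).Dom := (M.dom_eq q d).2 (Part.dom_iff_mem.2 ⟨_, h⟩)
  exact ⟨_, hk.mem_step.2 ⟨h, Part.get_mem h₁⟩⟩

theorem mem_run_append_singleton {r r' : ℕ × Output} {l : List Datum} {d : Datum} :
    r' ∈ run k r (l ++ [d]) ↔
      ∃ q o, (q, o) ∈ run k r l ∧ ∃ o₁, (r'.1, o₁) ∈ step k q d ∧ r'.2 = (o₁ <|> o) := by
  obtain ⟨q', o'⟩ := r'
  simp only [run_append_singleton, stepLatest, Part.mem_bind_iff, Part.mem_map_iff, Prod.exists,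
    Prod.mk.injEq]
  constructor
  · rintro ⟨q, o, h, q₁, o₁, h₁, rfl, rfl⟩
    exact ⟨q, o, h, o₁, h₁, rfl⟩
  · rintro ⟨q, o, h, o₁, h₁, rfl⟩
    exact ⟨q, o, h, q', o₁, h₁, rfl, rfl⟩

theorem mem_run_append {r r' : ℕ × Output} {l l' : List Datum} :
    r' ∈ run k r (l ++ l') ↔ ∃ r₁ ∈ run k r l, r' ∈ run k r₁ l' := by
  rw [run_append, Part.mem_bind_iff]

theorem Describes.mem_state (hk : Describes k M) {p q : ℕ} {o o' : Output} {l₀ l : List Datum}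
    (hp : p ∈ M.state l₀) (h : (q, o') ∈ run k (p, o) l) : q ∈ M.state (l₀ ++ l) := by
  induction l using List.reverseRecOn generalizing q o' with
  | nil =>
    rw [run_nil, Part.mem_some_iff, Prod.mk.injEq] at h
    simpa [h.1] using hp
  | append_singleton l d ih =>
    obtain ⟨q₁, o₁, h₁, o₂, h₂, -⟩ := mem_run_append_singleton.1 h
    rw [← List.append_assoc, BMSLearner.state_append]
    exact Part.mem_bind (ih h₁) (hk.mem_step.1 h₂).1

theorem Describes.exists_mem_run (hk : Describes k M) {p q : ℕ} {l₀ l : List Datum}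
    (hp : p ∈ M.state l₀) (h : q ∈ M.state (l₀ ++ l)) (o : Output) :
    ∃ o', (q, o') ∈ run k (p, o) l := by
  induction l using List.reverseRecOn generalizing q with
  | nil =>
    rw [List.append_nil] at h
    rw [Part.mem_unique h hp]
    exact ⟨o, Part.mem_some _⟩
  | append_singleton l d ih =>
    rw [← List.append_assoc, BMSLearner.state_append, Part.mem_bind_iff] at h
    obtain ⟨q₁, h₁, h₂⟩ := h
    obtain ⟨o₁, h₃⟩ := ih h₁
    obtain ⟨o₂, h₄⟩ := hk.exists_mem_step h₂
    exact ⟨_, mem_run_append_singleton.2 ⟨q₁, o₁, h₃, o₂, h₄, rfl⟩⟩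

/-- A change of the latest proper output is due to some output. -/
theorem Describes.exists_output (hk : Describes k M) {p q : ℕ} {o o' : Output}
    {l₀ l : List Datum} (hp : p ∈ M.state l₀) (h : (q, o') ∈ run k (p, o) l) (ho : o' ≠ o) :
    ∃ g, o' = some g ∧ ∃ l₁, l₁ <+: l ∧ some g ∈ M.hyp (l₀ ++ l₁) := by
  induction l using List.reverseRecOn generalizing q o' with
  | nil =>
    rw [run_nil, Part.mem_some_iff, Prod.mk.injEq] at h
    exact absurd h.2 ho
  | append_singleton l d ih =>
    obtain ⟨q₁, o₁, h₁, o₂, h₂, h₃⟩ := mem_run_append_singleton.1 h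
    simp only at h₂ h₃
    rcases o₂ with _ | g
    · replace h₃ : o' = o₁ := by simpa using! h₃
      subst h₃
      obtain ⟨g, hg, l₁, h₄, h₅⟩ := ih h₁ ho
      exact ⟨g, hg, l₁, h₄.trans (List.prefix_append _ _), h₅⟩
    · refine ⟨g, by simpa using! h₃, l ++ [d], List.prefix_rfl, ?_⟩
      rw [← List.append_assoc, BMSLearner.hyp_append]
      exact Part.mem_bind (hk.mem_state hp h₁) (hk.mem_step.1 h₂).2

/-- The initial output never influences the run; it is only the fallback if nothing proper is put
out. -/
theorem run_eq_map (k : Code) (p : ℕ) (o : Output) (l : List Datum) :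
    run k (p, o) l = (run k (p, none) l).map fun r => (r.1, r.2 <|> o) := by
  induction l using List.reverseRecOn with
  | nil => simp [run_nil]
  | append_singleton l d ih =>
    rw [run_append_singleton, run_append_singleton, ih, Part.map_bind, Part.bind_map]
    congr 1
    funext r
    rw [stepLatest, stepLatest, Part.map_map]
    congr 1
    funext a
    rcases a with ⟨a, _ | b⟩ <;> simp

/-- From `t₀` on, `M` puts out `g` and no other hypothesis on `T`. -/
def ConvergesTo (M : BMSLearner) (T : Text) (t₀ g : ℕ) : Prop :=
  some g ∈ M.hyp (T.take t₀) ∧ ∀ t, t₀ ≤ t → ∀ q, some q ∈ M.hyp (T.take t) → q = g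

theorem Describes.latest_eq (hk : Describes k M) {T : Text} {t₀ g : ℕ}
    (hT : ConvergesTo M T t₀ g) {t : ℕ} (ht : t₀ ≤ t) {q : ℕ} {o : Output}
    (h : (q, o) ∈ run k (0, none) (T.take t)) : o = some g := by
  induction t, ht using Nat.le_induction generalizing q o with
  | base =>
    cases t₀ with
    | zero => simpa [Text.take_zero, BMSLearner.hyp_nil] using! hT.1
    | succ t =>
      have h₁ := hT.1
      rw [Text.take_succ] at h h₁
      obtain ⟨q₁, o₁, h₂, o₂, h₃, h₄⟩ := mem_run_append_singleton.1 h
      rw [BMSLearner.hyp_append, Part.mem_bind_iff] at h₁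
      obtain ⟨q₂, h₅, h₆⟩ := h₁
      have h₇ := hk.mem_state (l₀ := []) (Part.mem_some 0) h₂
      rw [List.nil_append] at h₇
      rw [Part.mem_unique h₅ h₇] at h₆
      rw [Part.mem_unique (hk.mem_step.1 h₃).2 h₆] at h₄
      simpa using! h₄
  | succ t ht ih =>
    rw [Text.take_succ] at h
    obtain ⟨q₁, o₁, h₁, o₂, h₂, h₃⟩ := mem_run_append_singleton.1 h
    rcases o₂ with _ | g'
    · rw [ih h₁] at h₃
      simpa using! h₃
    · have h₄ := hk.mem_state (l₀ := []) (Part.mem_some 0) h₁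
      rw [List.nil_append] at h₄
      have h₅ : some g' ∈ M.hyp (T.take (t + 1)) := by
        rw [Text.take_succ, BMSLearner.hyp_append]
        exact Part.mem_bind h₄ (hk.mem_step.1 h₂).2
      rw [hT.2 (t + 1) (by omega) g' h₅] at h₃
      simpa using! h₃

/-- The final hypothesis is the latest proper output in the part of the text after `l₀`, or, if
there is none, the latest one in `l₀`. -/
theorem Describes.latest_append_eq (hk : Describes k M) {T : Text} {t₀ g : ℕ}
    (hT : ConvergesTo M T t₀ g) {t : ℕ} (ht : t₀ ≤ t) {l₀ l : List Datum}
    (hl : T.take t = l₀ ++ l) {p q : ℕ} {o₀ o : Output}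
    (hp : (p, o₀) ∈ run k (0, none) l₀) (h : (q, o) ∈ run k (p, none) l) :
    (o <|> o₀) = some g := by
  refine hk.latest_eq hT ht (q := q) ?_
  rw [hl, mem_run_append]
  refine ⟨_, hp, ?_⟩
  rw [run_eq_map]
  exact Part.mem_map _ h

/-! ### The chain of new states -/

theorem plains_append (k : Code) (l l' : List ℕ) :
    plains k (l ++ l') = plains k l ++ plains k l' := by
  simp [plains]

theorem mem_listContent_plains {l : List ℕ} {v : ℕ} :
    v ∈ listContent (plains k l) ↔ ∃ i ∈ l, v = plain k i := by
  simp [listContent, plains, eq_comm]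

theorem exists_of_mem_chain_succ {j : ℕ} {r : List ℕ × List ℕ} (h : r ∈ chain k (j + 1)) :
    ∃ r' ∈ chain k j, ∃ i q, (i, q) ∈ newState (k, r'.2) ∧ r = (r'.1 ++ [i], q :: r'.2) := by
  rw [chain_succ, Part.mem_bind_iff] at h
  obtain ⟨r', h₁, h₂⟩ := h
  rw [Part.mem_map_iff] at h₂
  obtain ⟨⟨i, q⟩, h₃, rfl⟩ := h₂
  exact ⟨r', h₁, i, q, h₃, rfl⟩

theorem Describes.chain_spec (hk : Describes k M) {j : ℕ} {r : List ℕ × List ℕ}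
    (h : r ∈ chain k j) :
    r.2.headI ∈ M.state (plains k r.1) ∧ r.2.Nodup ∧ r.2.length = j + 1 ∧
      ∀ q ∈ r.2, ∃ σ₁ σ₂, r.1 = σ₁ ++ σ₂ ∧ q ∈ M.state (plains k σ₁) := by
  induction j generalizing r with
  | zero =>
    obtain rfl := Part.mem_some_iff.1 h
    exact ⟨Part.mem_some 0, by simp, rfl, fun q hq =>
      ⟨[], [], rfl, by rw [List.mem_singleton.1 hq]; exact Part.mem_some 0⟩⟩
  | succ j ih =>
    obtain ⟨r', h₁, i, q, h₂, rfl⟩ := exists_of_mem_chain_succ h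
    obtain ⟨h₃, h₄, h₅, h₆⟩ := ih h₁
    obtain ⟨⟨o, h₇⟩, h₈⟩ := newState_spec h₂
    have h₉ : q ∈ M.state (plains k (r'.1 ++ [i])) := by
      rw [plains_append]
      exact (BMSLearner.state_append M _ _).symm ▸ Part.mem_bind h₃ (hk.mem_step.1 h₇).1
    refine ⟨h₉, List.nodup_cons.2 ⟨h₈, h₄⟩, by simp [h₅], fun q' hq' => ?_⟩
    rcases List.mem_cons.1 hq' with rfl | hq'
    · exact ⟨_, [], by simp, h₉⟩
    · obtain ⟨σ₁, σ₂, h₁₀, h₁₁⟩ := h₆ q' hq'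
      exact ⟨σ₁, σ₂ ++ [i], by simp [h₁₀], h₁₁⟩

theorem chain_subset {j n : ℕ} {r r' : List ℕ × List ℕ} (h : r ∈ chain k j)
    (h' : r' ∈ chain k (j + n)) : r.1 ⊆ r'.1 := by
  induction n generalizing r' with
  | zero => rw [Part.mem_unique h h']; exact List.Subset.refl _
  | succ n ih =>
    obtain ⟨r₁, h₁, i, q, -, rfl⟩ := exists_of_mem_chain_succ h'
    exact fun a ha => List.mem_append_left _ (ih h₁ ha)

/-- If the chain does not end, then `M` visits infinitely many states on a text for `base k`. -/
theorem Describes.exists_text_of_chain_dom (hk : Describes k M) (h : ∀ j, (chain k j).Dom) :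
    ∃ T : Text, T.content = base k ∧ ¬ M.FinitelyManyStates T := by
  have hr : ∀ j, ∃ r, r ∈ chain k j := fun j => Part.dom_iff_mem.1 (h j)
  choose r hr using hr
  have hi : ∀ j, ∃ i, (r (j + 1)).1 = (r j).1 ++ [i] := fun j => by
    obtain ⟨r', h₁, i, q, -, h₂⟩ := exists_of_mem_chain_succ (hr (j + 1))
    exact ⟨i, by rw [h₂, Part.mem_unique h₁ (hr j)]⟩
  choose i hi using hi
  have htake : ∀ j, Text.take (fun j => some (plain k (i j))) j = plains k (r j).1 := by
    intro j
    induction j with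
    | zero =>
      have : r 0 = ([], [0]) := Part.mem_some_iff.1 (hr 0)
      simp [this, Text.take_zero, plains]
    | succ j ih =>
      rw [Text.take_succ, ih, hi, plains_append]
      rfl
  refine ⟨fun j => some (plain k (i j)), ?_, fun hfin => ?_⟩
  · ext v
    constructor
    · rintro ⟨j, hj⟩
      refine ⟨i j, j + 1, _, hr _, (Option.some.inj hj).symm, ?_⟩
      simp [hi]
    · rintro ⟨a, j, r', h₁, rfl, h₂⟩
      rw [Part.mem_unique h₁ (hr j)] at h₂
      refine Text.listContent_take_subset _ j ?_
      rw [htake]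
      exact mem_listContent_plains.2 ⟨a, h₂, rfl⟩
  -- After `n` links the chain has passed `n + 1` distinct states, all visited on the text: one too
  -- many.
  · set n := hfin.toFinset.card with hn
    obtain ⟨-, h₁, h₂, h₃⟩ := hk.chain_spec (hr n)
    have h₄ : (r n).2.toFinset ⊆ hfin.toFinset := by
      intro q hq
      obtain ⟨σ₁, σ₂, h₅, h₆⟩ := h₃ q (List.mem_toFinset.1 hq)
      refine hfin.mem_toFinset.2 ⟨σ₁.length, ?_⟩
      have h₇ := htake n
      rw [h₅, plains_append] at h₇
      have h₈ : σ₁.length ≤ n := by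
        have := congrArg List.length h₇
        simp [Text.length_take, plains] at this
        omega
      obtain ⟨m, hm⟩ := Nat.exists_eq_add_of_le h₈
      rw [congrArg (Text.take _) hm, Text.take_add] at h₇
      have h₉ := (List.append_inj h₇ (by simp [Text.length_take, plains])).1
      rwa [h₉]
    have h₅ := Finset.card_le_card h₄
    rw [List.toFinset_card_of_nodup h₁, h₂] at h₅
    omega

/-- If `M` is successful on `base k`, then the chain ends, and every further plain element takes
`M` back to a former state. -/
theorem Describes.exists_dead_end (hk : Describes k M)
    (h : ∀ T : Text, T.content = base k → M.FinitelyManyStates T) :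
    ∃ σ p, base k = {v | ∃ i ∈ σ, v = plain k i} ∧ p ∈ M.state (plains k σ) ∧
      ∀ i, ∀ q ∈ M.state (plains k σ ++ [some (plain k i)]),
        ∃ σ₁ σ₂, σ = σ₁ ++ σ₂ ∧ q ∈ M.state (plains k σ₁) := by
  have h₁ : ∃ j, ¬ (chain k j).Dom := by
    by_contra! h₁
    obtain ⟨T, hT, hT'⟩ := hk.exists_text_of_chain_dom h₁
    exact hT' (h T hT)
  classical
  obtain ⟨j, hj⟩ : ∃ j, Nat.find h₁ = j + 1 := by
    refine Nat.exists_eq_succ_of_ne_zero fun h₂ => Nat.find_spec h₁ ?_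
    rw [h₂]
    trivial
  have h₂ : ¬ (chain k (j + 1)).Dom := hj ▸ Nat.find_spec h₁
  obtain ⟨r, hr⟩ := Part.dom_iff_mem.1 (not_not.1 (Nat.find_min h₁ (m := j) (by omega)))
  obtain ⟨h₃, -, -, h₄⟩ := hk.chain_spec hr
  refine ⟨r.1, r.2.headI, ?_, h₃, fun i q hq => h₄ q ?_⟩
  · ext v
    constructor
    · rintro ⟨i, j', r', h₅, rfl, h₆⟩
      refine ⟨i, ?_, rfl⟩
      rcases le_or_gt j' j with h₇ | h₇
      · obtain ⟨n, rfl⟩ := Nat.exists_eq_add_of_le h₇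
        exact chain_subset h₅ hr h₆
      -- No stage after `j` is defined, because each stage requires the one before it and stage `j +
      -- 1` is undefined.
      · exfalso
        obtain ⟨n, rfl⟩ := Nat.exists_eq_add_of_le (Nat.succ_le_of_lt h₇)
        clear h₆ h₇
        induction n generalizing r' with
        | zero => exact h₂ (Part.dom_iff_mem.2 ⟨_, h₅⟩)
        | succ n ih =>
          obtain ⟨r₁, h₈, -⟩ := exists_of_mem_chain_succ h₅
          exact ih _ h₈
    · rintro ⟨i, hi, rfl⟩
      exact ⟨i, j, r, hr, rfl, hi⟩
  · by_contra hq'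
    rw [BMSLearner.state_append, Part.mem_bind_iff] at hq
    obtain ⟨p, h₅, h₆⟩ := hq
    rw [Part.mem_unique h₅ h₃] at h₆
    obtain ⟨o, h₇⟩ := hk.exists_mem_step h₆
    refine h₂ ?_
    obtain ⟨a, ha⟩ := Part.dom_iff_mem.1 (newState_dom h₇ hq')
    refine Part.dom_iff_mem.2 ⟨(r.1 ++ [a.1], a.2 :: r.2), ?_⟩
    rw [chain_succ]
    exact Part.mem_bind hr (Part.mem_map _ ha)

/-- Every plain element on which `M` is defined after `σ` can be inserted into a loop that returns
to the state after `σ`. -/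
theorem exists_loop_of_dead_end {σ : List ℕ} {p : ℕ} (hp : p ∈ M.state (plains k σ))
    (hσ : ∀ i, ∀ q ∈ M.state (plains k σ ++ [some (plain k i)]),
      ∃ σ₁ σ₂, σ = σ₁ ++ σ₂ ∧ q ∈ M.state (plains k σ₁)) (N : ℕ)
    (hd : ∀ i < N, (M.state (plains k σ ++ [some (plain k i)])).Dom) :
    ∃ l, p ∈ M.state (plains k l) ∧ ∀ i, i ∈ l ↔ i ∈ σ ∨ i < N := by
  induction N with
  | zero => exact ⟨σ, hp, by simp⟩
  | succ N ih =>
    obtain ⟨l, h₁, h₂⟩ := ih fun i hi => hd i (by omega)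
    obtain ⟨q, hq⟩ := Part.dom_iff_mem.1 (hd N (by omega))
    obtain ⟨σ₁, σ₂, h₃, h₄⟩ := hσ N q hq
    rw [BMSLearner.state_append_congr hp h₁] at hq
    -- The element `N` throws the learner back to its state after `σ₁`, and reading the rest `σ₂` of
    -- `σ` once more restores `p`.
    refine ⟨l ++ [N] ++ σ₂, ?_, fun i => ?_⟩
    · rw [plains_append, plains_append]
      have h₅ := BMSLearner.state_append_congr h₄ hq (plains k σ₂)
      rw [← plains_append, ← h₃] at h₅
      exact h₅ ▸ hp
    · simp only [List.mem_append, List.mem_singleton, h₂, Nat.lt_succ_iff_lt_or_eq]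
      have : i ∈ σ₂ → i ∈ σ := fun h => h₃ ▸ List.mem_append_right _ h
      tauto

/-! ### Loops on pauses and the contradiction -/

/-- The mark `w`, followed by pauses. -/
def pauseText (k : Code) (w : Mark) : Text := Text.prepend [some (mark k w)] fun _ => none

theorem take_pauseText (k : Code) (w : Mark) (n : ℕ) :
    (pauseText k w).take (n + 1) = markPauses k w n := by
  rw [pauseText, add_comm, markPauses]
  exact Text.take_prepend [some (mark k w)] (fun _ => none) n

theorem content_pauseText (k : Code) (w : Mark) : (pauseText k w).content = {mark k w} := by
  rw [pauseText, Text.content_prepend]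
  ext v
  simp [Text.content, listContent]

theorem markPauses_add (k : Code) (w : Mark) (n d : ℕ) :
    markPauses k w (n + d) = markPauses k w n ++ (List.range d).map fun _ => none := by
  simp [markPauses]

theorem listContent_markPauses (k : Code) (w : Mark) (n : ℕ) :
    listContent (markPauses k w n) = {mark k w} := by
  ext v
  simp [markPauses, listContent]

theorem take_prepend_pauseText (k : Code) (w : Mark) (l : List Datum) (n : ℕ) :
    (Text.prepend l (pauseText k w)).take (l.length + (n + 1)) = l ++ markPauses k w n := by
  rw [Text.take_prepend, take_pauseText]

/-- The run is deterministic, so a repetition of state and latest output after `d` pauses recurs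
with period `d`. -/
theorem mem_run_loop {p q : ℕ} {o : Output} {w : Mark} {n d : ℕ}
    (h₁ : (q, o) ∈ run k (p, none) (markPauses k w n))
    (h₂ : (q, o) ∈ run k (p, none) (markPauses k w (n + d))) (j : ℕ) :
    (q, o) ∈ run k (p, none) (markPauses k w (n + j * d)) := by
  induction j with
  | zero => simpa using h₁
  | succ j ih =>
    rw [markPauses_add, mem_run_append] at h₂
    obtain ⟨r, h₃, h₄⟩ := h₂
    rw [Part.mem_unique h₃ h₁] at h₄
    rw [Nat.succ_mul, ← add_assoc, markPauses_add, mem_run_append]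
    exact ⟨_, ih, h₄⟩

theorem _root_.LearnsEx.exists_convergesTo {T : Text} (h : LearnsEx φ M.hyp T) :
    ∃ t₀ g, ConvergesTo M T t₀ g ∧ langOf φ g = T.content := by
  obtain ⟨-, t₀, g, h₁, h₂, h₃⟩ := h
  exact ⟨t₀, g, ⟨h₁, h₃⟩, h₂⟩

theorem Describes.exists_mem_run_zero (hk : Describes k M) {p : ℕ} {l : List Datum}
    (hp : p ∈ M.state l) : ∃ o, (p, o) ∈ run k (0, none) l :=
  hk.exists_mem_run (l₀ := []) (Part.mem_some 0) hp none

/-- A hypothesis that `M` holds in a loop on pauses is the final one on pauses. -/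
theorem Describes.eq_of_mem_run_loop (hk : Describes k M) {p q h : ℕ} {w : Mark} {n d : ℕ}
    (hd : 0 < d) (h₁ : (q, some h) ∈ run k (p, none) (markPauses k w n))
    (h₂ : (q, some h) ∈ run k (p, none) (markPauses k w (n + d))) {l : List Datum}
    (hp : p ∈ M.state l) {t₀ g : ℕ}
    (hT : ConvergesTo M (Text.prepend l (pauseText k w)) t₀ g) : h = g := by
  obtain ⟨o, ho⟩ := hk.exists_mem_run_zero hp
  have ht : t₀ ≤ l.length + (n + t₀ * d + 1) := by
    have := Nat.le_mul_of_pos_right t₀ hd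
    omega
  have h₃ := hk.latest_append_eq hT ht (take_prepend_pauseText k w l _) ho
    (mem_run_loop h₁ h₂ t₀)
  simpa using! h₃

theorem mem_reactionRuns {w : Mark} {n₁ n₂ m : ℕ}
    {r : (ℕ × Output) × (ℕ × Output) × (ℕ × Output)} :
    r ∈ reactionRuns k w n₁ n₂ m ↔ ∃ r₀ ∈ run k (0, none) (plains k w.1),
      r.1 ∈ run k (r₀.1, none) (markPauses k w n₁) ∧
      r.2.1 ∈ run k (r₀.1, none) (markPauses k w n₂) ∧
      r.2.2 ∈ run k r.1 (plains k (List.range m)) := by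
  obtain ⟨r₁, r₂, r₃⟩ := r
  simp only [reactionRuns, Part.mem_bind_iff, Part.mem_map_iff, Prod.mk.injEq]
  constructor
  · rintro ⟨r₀, h₀, _, h₁, _, h₂, _, h₃, rfl, rfl, rfl⟩
    exact ⟨r₀, h₀, h₁, h₂, h₃⟩
  · rintro ⟨r₀, h₀, h₁, h₂, h₃⟩
    exact ⟨r₀, h₀, r₁, h₁, r₂, h₂, r₃, h₃, rfl, rfl, rfl⟩

/-- A strongly non-U-shaped learner has no reactions at a dead end. -/
theorem Describes.reactsAt_eq_false (hk : Describes k M)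
    (hM : ∀ K ∈ collection, ∀ T : Text, T.content = K →
      StronglyNonUShaped φ M.hyp T ∧ LearnsEx φ M.hyp T)
    {σ : List ℕ} {p : ℕ} (hbase : base k = {v | ∃ i ∈ σ, v = plain k i})
    (hp : p ∈ M.state (plains k σ))
    (hσ : ∀ i, ∀ q ∈ M.state (plains k σ ++ [some (plain k i)]),
      ∃ σ₁ σ₂, σ = σ₁ ++ σ₂ ∧ q ∈ M.state (plains k σ₁)) (b : Bool) (s : ℕ) :
    reactsAt (k, (σ, b)) s = false := by
  classical
  by_contra hs
  have hex : ∃ s, reactsAt (k, (σ, b)) s = true := ⟨s, by simpa using hs⟩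
  obtain ⟨m, hm, n₁, n₂, hlt, ⟨r₁, r₂, q₃, o₃⟩, hr, h₁, h₂, h₃⟩ :=
    exists_reaction_of_reactsAt (Nat.find_spec hex)
  obtain ⟨⟨p', o₀⟩, hr₀, hr₁, hr₂, hr₃⟩ := mem_reactionRuns.1 hr
  obtain rfl : p' = p := Part.mem_unique (hk.mem_state (l₀ := []) (Part.mem_some 0) hr₀) hp
  obtain ⟨d, rfl⟩ := Nat.exists_eq_add_of_lt hlt
  obtain ⟨q, o⟩ := r₁
  simp only at h₁ h₂ h₃ hr₁ hr₂ hr₃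
  subst h₁
  obtain ⟨h, rfl⟩ := Option.ne_none_iff_exists'.1 h₂
  have hK : marked k (σ, b) true ∈ collection := ⟨k, Or.inr ⟨_, _, hbase, rfl⟩⟩
  have hplain : ∀ i, plain k i ∈ marked k (σ, b) true ↔ i ∈ σ ∨ i ≤ Nat.find hex := by
    intro i
    rw [plain_mem_marked]
    have : (∀ s < i, reactsAt (k, (σ, b)) s = false) ↔ i ≤ Nat.find hex := by
      simp [Nat.le_find_iff]
    rw [this]
    simp
  have hplains : ∀ l : List ℕ, (∀ i ∈ l, i ∈ σ ∨ i ≤ Nat.find hex) →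
      listContent (plains k l) ⊆ marked k (σ, b) true := by
    intro l hl v hv
    obtain ⟨i, hi, rfl⟩ := mem_listContent_plains.1 hv
    exact (hplain i).2 (hl i hi)
  -- The detour `l` presents all plain elements of the target and still ends in state `p`. `M` is
  -- defined on each of them after `σ`, since it learns the target.
  obtain ⟨l, hl, hl'⟩ := exists_loop_of_dead_end hp hσ (Nat.find hex + 1) fun i hi => by
    have h₄ : listContent (plains k (σ ++ [i])) ⊆ marked k (σ, b) true := by
      refine hplains _ fun j hj => ?_
      rcases List.mem_append.1 hj with hj | hj
      · exact Or.inl hj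
      · rw [List.mem_singleton.1 hj]
        exact Or.inr (by omega)
    have h₅ := BMSLearner.dom_state_of_learnsEx_prepend
      (hM _ hK _ (Text.content_prepend_ofSet h₄)).2
    rwa [plains_append] at h₅
  have hl'' : listContent (plains k l) ⊆ marked k (σ, b) true :=
    hplains l fun i hi => ((hl' i).1 hi).imp_right Nat.le_of_lt_succ
  have hT₁ : (Text.prepend (plains k l) (pauseText k (σ, b))).content = marked k (σ, b) true := by
    rw [Text.content_prepend, content_pauseText]
    refine Set.Subset.antisymm (Set.union_subset hl'' ?_) ?_
    · exact Set.singleton_subset_iff.2 (mark_mem_marked.2 rfl)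
    · intro v hv
      have hv' := hv
      rcases hv' with rfl | ⟨i, rfl, -⟩
      · exact Or.inr rfl
      · refine Or.inl (mem_listContent_plains.2 ⟨i, (hl' i).2 ?_, rfl⟩)
        exact ((hplain i).1 hv).imp_right Nat.lt_succ_of_le
  obtain ⟨t₁, g, hg, hg'⟩ := (hM _ hK _ hT₁).2.exists_convergesTo
  -- On `l`, the mark and pauses the learner ends in the recorded loop, so `h` is its final
  -- hypothesis there and hence correct for the target.
  obtain rfl := hk.eq_of_mem_run_loop (Nat.succ_pos d) hr₁ hr₂ hl hg
  -- A second text for the same target, which leaves the loop with the plain elements that cause the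
  -- reaction.
  have hT₂ : (Text.prepend (plains k l ++ markPauses k (σ, b) n₁ ++ plains k (List.range m))
      (Text.ofSet (marked k (σ, b) true))).content = marked k (σ, b) true := by
    refine Text.content_prepend_ofSet ?_
    rw [listContent_append, listContent_append, listContent_markPauses]
    refine Set.union_subset (Set.union_subset hl'' ?_) (hplains _ fun i hi => Or.inr ?_)
    · exact Set.singleton_subset_iff.2 (mark_mem_marked.2 rfl)
    · have := List.mem_range.1 hi
      omega
  obtain ⟨h', h₄, l₁, hl₁, h₅⟩ := hk.exists_output hl hr₁ h₂
  obtain rfl := Option.some.inj h₄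
  obtain ⟨h', rfl, l₂, hl₂, h₆⟩ := hk.exists_output (hk.mem_state hl hr₁) hr₃ h₃
  obtain ⟨hsnu, hex₂⟩ := hM _ hK _ hT₂
  obtain ⟨t₂, g₂, hg₂, hg₂'⟩ := hex₂.exists_convergesTo
  rw [hT₁] at hg'
  have hpre₁ : plains k l ++ l₁ <+:
      plains k l ++ markPauses k (σ, b) n₁ ++ plains k (List.range m) :=
    ((List.prefix_append_right_inj _).2 hl₁).trans (List.prefix_append _ _)
  have hpre₂ : plains k l ++ markPauses k (σ, b) n₁ ++ l₂ <+:
      plains k l ++ markPauses k (σ, b) n₁ ++ plains k (List.range m) :=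
    (List.prefix_append_right_inj _).2 hl₂
  rw [← Text.take_prepend_of_prefix hpre₁ (Text.ofSet (marked k (σ, b) true))] at h₅
  rw [← Text.take_prepend_of_prefix hpre₂ (Text.ofSet (marked k (σ, b) true))] at h₆
  have hle : (plains k l ++ l₁).length ≤ (plains k l ++ markPauses k (σ, b) n₁ ++ l₂).length := by
    have := hl₁.length_le
    simp only [List.length_append]
    omega
  refine h₃ (congrArg some (Eq.symm ?_))
  -- A correct hypothesis is needed at or after the changed output `h'`: the one at `t₂` if this
  -- comes later, and otherwise `h'` itself, which has then already converged.
  rcases le_total (plains k l ++ markPauses k (σ, b) n₁ ++ l₂).length t₂ with h₇ | h₇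
  · exact hsnu _ _ t₂ _ _ _ hle h₇ h₅ h₆ hg₂.1 (hg'.trans hT₂.symm) hg₂'
  · have h₈ := hg₂.2 _ h₇ _ h₆
    exact hsnu _ _ _ _ _ _ hle le_rfl h₅ h₆ h₆ (hg'.trans hT₂.symm) (h₈ ▸ hg₂')

theorem content_prepend_pauseText_of_no_reaction {σ : List ℕ} {b : Bool}
    (hr : ∀ s, reactsAt (k, (σ, b)) s = false) :
    (Text.prepend (plains k σ) (pauseText k (σ, b))).content = marked k (σ, b) false := by
  rw [Text.content_prepend, content_pauseText]
  ext v
  constructor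
  · rintro (hv | rfl)
    · obtain ⟨i, hi, rfl⟩ := mem_listContent_plains.1 hv
      exact plain_mem_marked.2 (Or.inl hi)
    · exact mark_mem_marked.2 rfl
  · intro hv
    have hv' := hv
    rcases hv' with rfl | ⟨i, rfl, -⟩
    · exact Or.inr rfl
    · rw [plain_mem_marked] at hv
      simp only [hr, Bool.false_eq_true, exists_false, or_self, and_false, or_false] at hv
      exact Or.inl (mem_listContent_plains.2 ⟨i, hv, rfl⟩)

theorem Describes.exists_mem_run_markPauses (hk : Describes k M) {σ : List ℕ} {p : ℕ} {w : Mark}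
    (hp : p ∈ M.state (plains k σ))
    (h : LearnsEx φ M.hyp (Text.prepend (plains k σ) (pauseText k w))) (n : ℕ) :
    ∃ q o, (q, o) ∈ run k (p, none) (markPauses k w n) ∧
      q ∈ M.state (plains k σ ++ markPauses k w n) := by
  have h₁ := BMSLearner.dom_state_of_learnsEx h ((plains k σ).length + (n + 1))
  rw [take_prepend_pauseText] at h₁
  obtain ⟨q, hq⟩ := Part.dom_iff_mem.1 h₁
  obtain ⟨o, ho⟩ := hk.exists_mem_run hp hq none
  exact ⟨q, o, ho, hq⟩

/-- At a dead end without reactions, `M` puts out a hypothesis after one of the two marks. -/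
theorem Describes.exists_output_after_mark (hk : Describes k M)
    (hM : ∀ K ∈ collection, ∀ T : Text, T.content = K → LearnsEx φ M.hyp T)
    {σ : List ℕ} {p : ℕ} (hbase : base k = {v | ∃ i ∈ σ, v = plain k i})
    (hp : p ∈ M.state (plains k σ)) (hr : ∀ b s, reactsAt (k, (σ, b)) s = false) :
    ∃ b n q h, (q, some h) ∈ run k (p, none) (markPauses k (σ, b) n) := by
  by_contra! hcon
  obtain ⟨o₀, ho₀⟩ := hk.exists_mem_run_zero hp
  -- Silence after both marks makes the last output on `σ` final for both languages, which differ in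
  -- their marks.
  have h₁ : ∀ b, ∃ g, o₀ = some g ∧ langOf φ g = marked k (σ, b) false := by
    intro b
    have hT := content_prepend_pauseText_of_no_reaction (hr b)
    have hL := hM _ ⟨k, Or.inr ⟨_, _, hbase, rfl⟩⟩ _ hT
    obtain ⟨t₀, g, hg, hg'⟩ := hL.exists_convergesTo
    obtain ⟨q, o, ho, -⟩ := hk.exists_mem_run_markPauses hp hL t₀
    have h₂ := hk.latest_append_eq hg (by omega) (take_prepend_pauseText _ _ _ t₀) ho₀ ho
    rcases o with _ | h
    · exact ⟨g, by simpa using! h₂, hg'.trans hT⟩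
    · exact absurd ho (hcon b t₀ q h)
  obtain ⟨g, rfl, h₂⟩ := h₁ false
  obtain ⟨g', h₃, h₄⟩ := h₁ true
  obtain rfl := Option.some.inj h₃
  have h₅ : mark k (σ, false) ∈ marked k (σ, true) false := by
    rw [← h₄, h₂]
    exact mark_mem_marked.2 rfl
  simpa using mark_mem_marked.1 h₅

/-- At a dead end without reactions, `M` holds a correct hypothesis in a loop on pauses after one
of the two marks. -/
theorem Describes.exists_loop_on_pauses (hk : Describes k M)
    (hM : ∀ K ∈ collection, ∀ T : Text, T.content = K →
      M.FinitelyManyStates T ∧ LearnsEx φ M.hyp T)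
    {σ : List ℕ} {p : ℕ} (hbase : base k = {v | ∃ i ∈ σ, v = plain k i})
    (hp : p ∈ M.state (plains k σ)) (hr : ∀ b s, reactsAt (k, (σ, b)) s = false) :
    ∃ b g q n₁ n₂, n₁ < n₂ ∧ langOf φ g = marked k (σ, b) false ∧
      (q, some g) ∈ run k (p, none) (markPauses k (σ, b) n₁) ∧
      (q, some g) ∈ run k (p, none) (markPauses k (σ, b) n₂) := by
  obtain ⟨b, n₀, q₀, h₀, hq₀⟩ :=
    hk.exists_output_after_mark (fun K hK T hT => (hM K hK T hT).2) hbase hp hr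
  have hT := content_prepend_pauseText_of_no_reaction (hr b)
  obtain ⟨hfin, hL⟩ := hM _ ⟨k, Or.inr ⟨_, _, hbase, rfl⟩⟩ _ hT
  obtain ⟨t₀, g, hg, hg'⟩ := hL.exists_convergesTo
  obtain ⟨o₀, ho₀⟩ := hk.exists_mem_run_zero hp
  -- After `n₀` pauses some hypothesis has been put out since the mark, and by `t₀` more the output
  -- has converged. From then on only the state can vary, and the pigeonhole principle gives a
  -- repetition.
  have h₁ : ∀ n, ∃ q, (q, some g) ∈ run k (p, none) (markPauses k (σ, b) (n₀ + (t₀ + n))) ∧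
      ∃ t, q ∈ M.state ((Text.prepend (plains k σ) (pauseText k (σ, b))).take t) := by
    intro n
    obtain ⟨q, o, ho, hq⟩ := hk.exists_mem_run_markPauses hp hL (n₀ + (t₀ + n))
    have h₂ := hk.latest_append_eq hg (by omega) (take_prepend_pauseText _ _ _ _) ho₀ ho
    have h₃ := ho
    rw [markPauses_add, mem_run_append] at h₃
    obtain ⟨r, h₄, h₅⟩ := h₃
    rw [Part.mem_unique h₄ hq₀, run_eq_map, Part.mem_map_iff] at h₅
    obtain ⟨⟨q', o'⟩, -, h₆⟩ := h₅
    obtain ⟨rfl, rfl⟩ := Prod.mk.inj h₆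
    refine ⟨_, ?_, _, (take_prepend_pauseText _ _ _ _).symm ▸ hq⟩
    rcases o' with _ | h
    · have h₇ : h₀ = g := by simpa using! h₂
      simpa [h₇] using! ho
    · have h₇ : h = g := by simpa using! h₂
      simpa [h₇] using! ho
  choose q hq hq' using h₁
  have := hfin.to_subtype
  obtain ⟨n₁, n₂, h₂, h₃⟩ := Finite.exists_ne_map_eq_of_infinite fun n =>
    (⟨q n, hq' n⟩ : {q : ℕ | ∃ t, q ∈
      M.state ((Text.prepend (plains k σ) (pauseText k (σ, b))).take t)})
  replace h₃ : q n₁ = q n₂ := congrArg Subtype.val h₃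
  rcases lt_or_gt_of_ne h₂ with h₄ | h₄
  · exact ⟨b, g, q n₁, _, _, by omega, hg'.trans hT, hq n₁, h₃ ▸ hq n₂⟩
  · exact ⟨b, g, q n₁, _, _, by omega, hg'.trans hT, h₃ ▸ hq n₂, hq n₁⟩

/-- In the absence of reactions the hypothesis `g` held on pauses survives all plain elements, so it
would have to name both the finite and the infinite language of the same mark. -/
theorem collection_notMem_stronglyNonUShaped :
    collection ∉ TxtBMSEx φ StronglyNonUShaped := by
  rintro ⟨-, M, hM⟩
  obtain ⟨k, hk⟩ := exists_code_step M
  change Describes k M at hk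
  obtain ⟨σ, p, hbase, hp, hσ⟩ :=
    hk.exists_dead_end fun T hT => (hM _ ⟨k, Or.inl rfl⟩ T hT).1
  have hr : ∀ b s, reactsAt (k, (σ, b)) s = false :=
    hk.reactsAt_eq_false (fun K hK T hT => (hM K hK T hT).2) hbase hp hσ
  obtain ⟨b, g, q, n₁, n₂, hlt, hg, h₁, h₂⟩ :=
    hk.exists_loop_on_pauses (fun K hK T hT => ⟨(hM K hK T hT).1, (hM K hK T hT).2.2⟩) hbase hp hr
  obtain ⟨o₀, ho₀⟩ := hk.exists_mem_run_zero hp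
  have h₃ : ∀ m, ∀ r ∈ run k (q, some g) (plains k (List.range m)), r.2 = some g := by
    intro m r hm
    by_contra hne
    obtain ⟨s, hs⟩ := exists_reactsAt_of_reaction (k := k) (w := (σ, b)) (m := m)
      ⟨n₁, n₂, hlt, ((q, some g), (q, some g), r),
        mem_reactionRuns.2 ⟨_, ho₀, h₁, h₂, hm⟩, rfl, by simp, hne⟩
    simp [hr b s] at hs
  -- The text enters the loop and then lists all plain elements; its language is the large one for
  -- the mark.
  have hT : (Text.prepend (plains k σ ++ markPauses k (σ, b) n₁)
      fun i => some (plain k i)).content = marked k (σ, b) true := by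
    rw [Text.content_prepend, listContent_append, listContent_markPauses]
    ext v
    constructor
    · rintro ((hv | rfl) | ⟨i, hi⟩)
      · obtain ⟨i, hi, rfl⟩ := mem_listContent_plains.1 hv
        exact plain_mem_marked.2 (Or.inl hi)
      · exact mark_mem_marked.2 rfl
      · rw [← Option.some.inj hi]
        exact plain_mem_marked.2 (Or.inr ⟨fun s _ => hr b s, Or.inl rfl⟩)
    · rintro (rfl | ⟨i, rfl, -⟩)
      · exact Or.inl (Or.inr rfl)
      · exact Or.inr ⟨i, rfl⟩
  have hL := (hM _ ⟨k, Or.inr ⟨_, _, hbase, rfl⟩⟩ _ hT).2.2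
  obtain ⟨t₀, g', hg', hg''⟩ := hL.exists_convergesTo
  have htake := Text.take_prepend (plains k σ ++ markPauses k (σ, b) n₁)
    (fun i => some (plain k i)) t₀
  have hq := hk.mem_state hp h₁
  have h₄ := BMSLearner.dom_state_of_learnsEx hL
    ((plains k σ ++ markPauses k (σ, b) n₁).length + t₀)
  rw [htake] at h₄
  obtain ⟨q', hq'⟩ := Part.dom_iff_mem.1 h₄
  obtain ⟨o, ho⟩ := hk.exists_mem_run (l := plains k (List.range t₀)) hq hq' (some g)
  have h₅ : o = some g' := by
    refine hk.latest_eq hg'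
      (Nat.le_add_left t₀ (plains k σ ++ markPauses k (σ, b) n₁).length) (q := q') ?_
    rw [htake]
    refine mem_run_append.2 ⟨_, mem_run_append.2 ⟨_, ho₀, ?_⟩, ho⟩
    rw [run_eq_map]
    exact Part.mem_map (fun r : ℕ × Output => (r.1, r.2 <|> o₀)) h₁
  obtain rfl : g = g' := Option.some.inj ((h₃ t₀ _ ho).symm.trans h₅)
  obtain ⟨i, hi⟩ := Infinite.exists_notMem_finset σ.toFinset
  have h₆ : plain k i ∈ marked k (σ, b) false := by
    rw [← hg, hg'', hT]
    exact plain_mem_marked.2 (Or.inr ⟨fun s _ => hr b s, Or.inl rfl⟩)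
  rw [plain_mem_marked] at h₆
  simp [hr] at h₆
  exact hi (List.mem_toFinset.2 h₆)

end Diagonal

/-! ### The relations between the restrictions -/

theorem TxtBMSEx_mono {φ : ℕ → ℕ →. ℕ} {δ δ' : (ℕ → ℕ →. ℕ) → Learner → Text → Prop}
    (h : ∀ M T, δ φ M T → δ' φ M T) : TxtBMSEx φ δ ⊆ TxtBMSEx φ δ' := by
  rintro 𝓛 ⟨h₁, M, hM⟩
  refine ⟨h₁, M, fun L hL T hT => ?_⟩
  obtain ⟨h₂, h₃, h₄⟩ := hM L hL T hT
  exact ⟨h₂, h _ _ h₃, h₄⟩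

theorem Conservative.stronglyNonUShaped {φ : ℕ → ℕ →. ℕ} {M : Learner} {T : Text}
    (h : Conservative φ M T) : StronglyNonUShaped φ M T :=
  fun r s _ p q _ hrs _ hp hq _ hpT _ =>
    h r s p q hrs hp hq (hpT ▸ T.listContent_take_subset s)

theorem StronglyMonotonic.monotonic {φ : ℕ → ℕ →. ℕ} {M : Learner} {T : Text}
    (h : StronglyMonotonic φ M T) : Monotonic φ M T :=
  fun s t p q hst hp hq => Set.inter_subset_inter_left _ (h s t p q hst hp hq)

theorem mainTheorem8 (φ : ℕ → ℕ →. ℕ) (hφ : AcceptableSystem φ) :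
    IncompRel (· ⊆ ·) (TxtBMSEx φ Conservative) (TxtBMSEx φ StronglyMonotonic) ∧
    IncompRel (· ⊆ ·) (TxtBMSEx φ Conservative) (TxtBMSEx φ Monotonic) ∧
    TxtBMSEx φ StronglyMonotonic ⊂ TxtBMSEx φ Monotonic ∧
    TxtBMSEx φ Monotonic ⊂ TxtBMSEx φ Unrestricted ∧
    TxtBMSEx φ Conservative ⊂ TxtBMSEx φ Unrestricted ∧
    TxtBMSEx φ StronglyNonUShaped ⊂ TxtBMSEx φ Unrestricted := by
  have hsm : TxtBMSEx φ StronglyMonotonic ⊆ TxtBMSEx φ Monotonic :=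
    TxtBMSEx_mono fun _ _ h => h.monotonic
  have hc : TxtBMSEx φ Conservative ⊆ TxtBMSEx φ StronglyNonUShaped :=
    TxtBMSEx_mono fun _ _ h => h.stronglyNonUShaped
  have hu : ∀ δ, TxtBMSEx φ δ ⊆ TxtBMSEx φ Unrestricted := fun δ =>
    TxtBMSEx_mono fun _ _ _ => trivial
  have h₁ := OddBounds.collection_mem_conservative hφ
  have h₂ := OddBounds.collection_notMem_monotonic (φ := φ)
  have h₃ := Diagonal.collection_mem_stronglyMonotonic hφ
  have h₄ := Diagonal.collection_notMem_stronglyNonUShaped (φ := φ)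
  refine ⟨⟨fun h => h₂ (hsm (h h₁)), fun h => h₄ (hc (h h₃))⟩,
    ⟨fun h => h₂ (h h₁), fun h => h₄ (hc (h (hsm h₃)))⟩,
    ⟨hsm, fun h => OddBounds.smallCollection_notMem_stronglyMonotonic
      (h (OddBounds.smallCollection_mem_monotonic hφ))⟩,
    ⟨hu _, fun h => h₂ (h (hu _ h₁))⟩, ⟨hu _, fun h => h₄ (hc (h (hu _ h₃)))⟩,
    ⟨hu _, fun h => h₄ (h (hu _ h₃))⟩⟩
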